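/- Let $\mathfrak g=\mathfrak g_{\bar 0}\oplus\mathfrak g_{\bar 1}=\bigoplus_{j\in\frac12\mathbb Z}\mathfrak g_j$ be a $\frac12\mathbb Z$-graded Lie superalgebra over $\mathbb C$ (components of arbitrary dimension) whose gradation is consistent: $\mathfrak g_{\bar 0}=\bigoplus_{i\in\mathbb Z}\mathfrak g_i$ and $\mathfrak g_{\bar 1}=\bigoplus_{i\in\mathbb Z}\mathfrak g_{i+\frac12}$. Put $\mathfrak g_{+}=\bigoplus_{j>0}\mathfrak g_{j}$. A graded subalgebra $\mathfrak p=\bigoplus_j\mathfrak p_j$ of $\mathfrak g$ is *parabolic* if $\mathfrak p_j=\mathfrak g_j$ for all $j\ge 0$ and $\mathfrak p_{-j}\ne 0$ for some $j>0$; it is *non-degenerate* if moreover $\mathfrak p_{-j}$ has finite codimension in $\mathfrak g_{-j}$ for all $j>0$. For $0\neq a\in\mathfrak g_{-\frac12}$ let $\mathfrak p^a=\bigoplus_j\mathfrak p^a_j$, where $\mathfrak p^a_j=\mathfrak g_j$ for $j\ge0$, $\mathfrak p^a_{-\frac12}$ is the sum of $\mathbb C a$ and all the spaces $[\cdots[[a,\mathfrak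 g_0],\mathfrak g_0],\cdots]$, and $\mathfrak p^a_{-k-\frac12}=[\mathfrak p^a_{-\frac12},\mathfrak p^a_{-k}]$ for $k\in\frac12\mathbb Z_{>0}$. A non-zero $a\in\mathfrak g_{-\frac12}$ is *non-degenerate* if $\mathfrak p^a$ is a non-degenerate parabolic subalgebra. Assume: * $(SP_1)$ $\mathfrak g_0$ is commutative; * $(SP_2)$ if $a\in\mathfrak g_{-k}$ with $k>0$ and $[a,\mathfrak g_{\frac12}]=0$, then $a=0$; * $(SP_3)$ for every non-degenerate parabolic subalgebra $\mathfrak p$ of $\mathfrak g$ there is a non-degenerate element $a$ with $\mathfrak p^a\subseteq\mathfrak p$; * $\dim\mathfrak g_{-j}=\infty$ for some $j>0$. For $\lambda\in\mathfrak g_0^*$ let $M(\lambda)=\mathcal U(\mathfrak g)\otimes_{\mathcal U(\mathfrak g_0\oplus\mathfrak g_+)}\mathbb C_\lambda$ be the Verma module, where $\mathfrak g_0$ acts on the one-dimensional space $\mathbb C_\lambda$ by $\lambda$ and $\mathfrak g_+$ acts by $0$, graded so that its highest weight vector $v_\lambda=1\otimes 1$ has degree $0$; let $L(\lambda)$ be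 its quotient by the maximal proper graded submodule. A non-zero vector $v$ is *singular* if $\mathfrak g_+v=0$. A graded module is *quasifinite* if all its homogeneous components are finite-dimensional. If $\mathfrak p$ is a parabolic subalgebra and $\lambda$ vanishes on $\mathfrak g_0\cap[\mathfrak p,\mathfrak p]$, then $\mathbb C_\lambda$ extends to $\mathfrak p$ by letting $\mathfrak p_j$ act by $0$ for $j<0$, and $M(\mathfrak g,\lambda,\mathfrak p)=\mathcal U(\mathfrak g)\otimes_{\mathcal U(\mathfrak p)}\mathbb C_\lambda$ is the generalized Verma module. Then for every $\lambda\in\mathfrak g_0^*$ the following are equivalent: 1. $M(\lambda)$ contains a singular vector $a v_\lambda\in M(\lambda)_{-\frac12}$ with $a\in\mathfrak g_{-\frac12}$ non-degenerate; 2. there is a non-degenerate $a\in\mathfrak g_{-\frac12}$ with $\lambda([\mathfrak g_{\frac12},a])=0$; 3. $L(\lambda)$ is quasifinite; 4. there is a non-degenerate $a\in\mathfrak g_{-\frac12}$ such that $\lambda$ vanishes on $\mathfrak g_0\cap[\mathfrak p^a,\mathfrak p^a]$ and $L(\lambda)$ is isomorphic, as a graded $\mathfrak g$-module, to the irreducible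 quotient (the quotient by the maximal proper graded submodule) of $M(\mathfrak g,\lambda,\mathfrak p^a)$. -/

import Mathlib

universe u v

/-- A Lie superalgebra over the complex numbers, on the vector space `V`. -/
structure LieSuperalgebra (V : Type u) [AddCommGroup V] [Module ℂ V] where
  /-- The even part `parity 0` and the odd part `parity 1`. -/
  parity : ZMod 2 → Submodule ℂ V
  isInternal_parity : DirectSum.IsInternal parity
  /-- The super bracket. -/
  bracket : V →ₗ[ℂ] V →ₗ[ℂ] V
  bracket_mem_parity : ∀ (α β : ZMod 2) (a b : V),
    a ∈ parity α → b ∈ parity β → bracket a b ∈ parity (α + β)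
  bracket_skew : ∀ (α β : ZMod 2) (a b : V), a ∈ parity α → b ∈ parity β →
    bracket a b = -((-1 : ℂ) ^ (α.val * β.val) • bracket b a)
  bracket_jacobi : ∀ (α β : ZMod 2) (a b c : V), a ∈ parity α → b ∈ parity β →
    bracket a (bracket b c) =
      bracket (bracket a b) c + (-1 : ℂ) ^ (α.val * β.val) • bracket b (bracket a c)

namespace LieSuperalgebra

variable {V : Type u} [AddCommGroup V] [Module ℂ V]

/-- A gradation of a Lie superalgebra by the half-integers. The half-integer `n / 2` is encoded by
the integer `n`: `deg n` is the homogeneous component of degree `n / 2`. -/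
structure HalfIntGrading (g : LieSuperalgebra V) where
  deg : ℤ → Submodule ℂ V
  isInternal_deg : DirectSum.IsInternal deg
  bracket_mem_deg : ∀ (m n : ℤ) (a b : V),
    a ∈ deg m → b ∈ deg n → g.bracket a b ∈ deg (m + n)

/-- Defining relations of the universal enveloping superalgebra:
`a b - (-1)^(α β) b a = [a, b]` for `a` of parity `α` and `b` of parity `β`. -/
inductive EnvRel (g : LieSuperalgebra V) : TensorAlgebra ℂ V → TensorAlgebra ℂ V → Prop
  | comm (α β : ZMod 2) (a b : V) (ha : a ∈ g.parity α) (hb : b ∈ g.parity β) :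
      EnvRel g
        (TensorAlgebra.ι ℂ a * TensorAlgebra.ι ℂ b
          - (-1 : ℂ) ^ (α.val * β.val) • (TensorAlgebra.ι ℂ b * TensorAlgebra.ι ℂ a))
        (TensorAlgebra.ι ℂ (g.bracket a b))

/-- The universal enveloping superalgebra `U(g)`. -/
abbrev Env (g : LieSuperalgebra V) : Type u := RingQuot g.EnvRel

/-- The canonical map `g → U(g)`. -/
noncomputable def toEnv (g : LieSuperalgebra V) : V →ₗ[ℂ] g.Env :=
  (RingQuot.mkAlgHom ℂ g.EnvRel).toLinearMap ∘ₗ TensorAlgebra.ι ℂ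

section GradedModules

variable {A : Type u} [Ring A] [Algebra ℂ A]
variable {M : Type u} [AddCommGroup M] [Module ℂ M] [Module A M] [IsScalarTower ℂ A M]

/-- A submodule is graded if it is the sum of its intersections with the homogeneous components
`ℳ n` of the ambient module. -/
def IsGradedSubmodule (ℳ : ℤ → Submodule ℂ M) (N : Submodule A M) : Prop :=
  N.restrictScalars ℂ = ⨆ n : ℤ, N.restrictScalars ℂ ⊓ ℳ n

/-- The sum of all proper graded submodules; for a highest weight module this is the
maximal (proper) graded submodule. -/
def maxGradedSubmodule (A : Type u) [Ring A] [Algebra ℂ A] [Module A M] [IsScalarTower ℂ A M]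
    (ℳ : ℤ → Submodule ℂ M) : Submodule A M :=
  sSup {N : Submodule A M | IsGradedSubmodule ℳ N ∧ N ≠ ⊤}

/-- The quotient by the maximal graded submodule. -/
abbrev IrrQuotient (A : Type u) [Ring A] [Algebra ℂ A] [Module A M] [IsScalarTower ℂ A M]
    (ℳ : ℤ → Submodule ℂ M) : Type u :=
  M ⧸ maxGradedSubmodule A ℳ

/-- The image of a gradation in the quotient by a submodule. -/
def quotientDeg (N : Submodule A M) (ℳ : ℤ → Submodule ℂ M) (n : ℤ) : Submodule ℂ (M ⧸ N) :=
  (ℳ n).map (N.mkQ.restrictScalars ℂ)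

/-- All homogeneous components are finite-dimensional. -/
def IsQuasifinite (ℳ : ℤ → Submodule ℂ M) : Prop :=
  ∀ n : ℤ, FiniteDimensional ℂ (ℳ n)

end GradedModules

namespace HalfIntGrading

variable {g : LieSuperalgebra V} (G : g.HalfIntGrading)

/-- The gradation is consistent with the parity: the even part is the sum of the components of
integral degree and the odd part is the sum of the others. -/
def IsConsistent : Prop :=
  ∀ α : ZMod 2, g.parity α = ⨆ (n : ℤ) (_ : (n : ZMod 2) = α), G.deg n

/-- The subalgebra `g₀ ⊕ g₊`. -/
def nonneg : Submodule ℂ V := ⨆ (n : ℤ) (_ : 0 ≤ n), G.deg n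

/-- Parabolic subalgebras; the homogeneous component of `p` of degree `n / 2` is
`p ⊓ G.deg n`. -/
structure IsParabolic (p : Submodule ℂ V) : Prop where
  bracket_mem : ∀ x ∈ p, ∀ y ∈ p, g.bracket x y ∈ p
  graded : p = ⨆ n : ℤ, p ⊓ G.deg n
  nonneg_le : G.nonneg ≤ p
  exists_neg : ∃ n : ℤ, n < 0 ∧ p ⊓ G.deg n ≠ ⊥

/-- Non-degenerate parabolic subalgebras: every component of negative degree has finite
codimension in the corresponding component of `g`. -/
def IsNondegParabolic (p : Submodule ℂ V) : Prop :=
  G.IsParabolic p ∧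
    ∀ n : ℤ, n < 0 → FiniteDimensional ℂ (G.deg n ⧸ p.comap (G.deg n).subtype)

/-- The span of the `m`-fold brackets `[⋯[[a, g₀], g₀], ⋯]`. -/
def iterBracket (a : V) : ℕ → Submodule ℂ V
  | 0 => Submodule.span ℂ {a}
  | m + 1 => Submodule.map₂ g.bracket (iterBracket a m) (G.deg 0)

/-- The components of negative degree of `pᵃ`: `paraNeg a k` is the component of degree
`-(k + 1) / 2`. -/
def paraNeg (a : V) : ℕ → Submodule ℂ V
  | 0 => ⨆ m : ℕ, G.iterBracket a m
  | k + 1 => Submodule.map₂ g.bracket (⨆ m : ℕ, G.iterBracket a m) (paraNeg a k)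

/-- The parabolic subalgebra `pᵃ` attached to an element `a ≠ 0` of degree `-1/2`. -/
def para (a : V) : Submodule ℂ V := G.nonneg ⊔ ⨆ k : ℕ, G.paraNeg a k

/-- Non-degenerate elements of degree `-1/2`. -/
def IsNondegElement (a : V) : Prop :=
  a ∈ G.deg (-1) ∧ a ≠ 0 ∧ G.IsNondegParabolic (G.para a)

/-- `g₀` is commutative. -/
def SP1 : Prop := ∀ x ∈ G.deg 0, ∀ y ∈ G.deg 0, g.bracket x y = 0

/-- An element of negative degree that commutes with the component of degree `1/2` is zero. -/
def SP2 : Prop :=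
  ∀ n : ℤ, n < 0 → ∀ a ∈ G.deg n, (∀ x ∈ G.deg 1, g.bracket a x = 0) → a = 0

/-- Every non-degenerate parabolic subalgebra contains `pᵃ` for some non-degenerate `a`. -/
def SP3 : Prop :=
  ∀ p : Submodule ℂ V, G.IsNondegParabolic p → ∃ a : V, G.IsNondegElement a ∧ G.para a ≤ p

/-- The component of degree `n / 2` of `U(g)`, spanned by the products of homogeneous elements of
`g` of total degree `n / 2`. -/
def envDeg (n : ℤ) : Submodule ℂ g.Env :=
  Submodule.span ℂ {w | ∃ l : List (ℤ × V), (∀ x ∈ l, x.2 ∈ G.deg x.1) ∧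
    (l.map Prod.fst).sum = n ∧ w = (l.map fun x => g.toEnv x.2).prod}

/-- The left ideal of `U(g)` generated by `x - χ(x)`, `x ∈ p`, where `p ⊇ g₀` is a graded
subalgebra and `χ` is the functional on `p` that is `μ` on `g₀` and zero on the other components. -/
def weightIdeal (p : Submodule ℂ V) (μ : Module.Dual ℂ (G.deg 0)) : Submodule g.Env g.Env :=
  Submodule.span g.Env
    ({w | ∃ h : G.deg 0, w = g.toEnv (h : V) - algebraMap ℂ g.Env (μ h)} ∪
      {w | ∃ n : ℤ, n ≠ 0 ∧ ∃ x ∈ p ⊓ G.deg n, w = g.toEnv x})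

/-- The module `U(g) ⊗_{U(p)} ℂ_μ` induced from the one-dimensional `p`-module on which `g₀` acts
by `μ` and the other components of `p` act by zero. Since `ℂ_μ = U(p) / ∑ U(p) (x - χ(x))`, it is
`U(g) / ∑ U(g) (x - χ(x))`, the sums being over `x ∈ p`; the generator `1 ⊗ 1` is the class
of `1`. -/
abbrev InducedModule (p : Submodule ℂ V) (μ : Module.Dual ℂ (G.deg 0)) : Type u :=
  g.Env ⧸ G.weightIdeal p μ

/-- The highest weight vector of the induced module. -/
def hwVector (p : Submodule ℂ V) (μ : Module.Dual ℂ (G.deg 0)) : G.InducedModule p μ :=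
  (G.weightIdeal p μ).mkQ 1

/-- The component of degree `n / 2` of the induced module: the highest weight vector has
degree `0`. -/
def inducedDeg (p : Submodule ℂ V) (μ : Module.Dual ℂ (G.deg 0)) (n : ℤ) :
    Submodule ℂ (G.InducedModule p μ) :=
  quotientDeg (G.weightIdeal p μ) G.envDeg n

/-- The irreducible quotient of an induced module: its quotient by the maximal graded
submodule. -/
abbrev IrrInduced (p : Submodule ℂ V) (μ : Module.Dual ℂ (G.deg 0)) : Type u :=
  IrrQuotient g.Env (G.inducedDeg p μ)

/-- The gradation of the irreducible quotient. -/
def irrInducedDeg (p : Submodule ℂ V) (μ : Module.Dual ℂ (G.deg 0)) (n : ℤ) :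
    Submodule ℂ (G.IrrInduced p μ) :=
  quotientDeg (maxGradedSubmodule g.Env (G.inducedDeg p μ)) (G.inducedDeg p μ) n

/-- The Verma module `M(μ)`. -/
abbrev Verma (μ : Module.Dual ℂ (G.deg 0)) : Type u := G.InducedModule G.nonneg μ

/-- The highest weight vector of `M(μ)`. -/
abbrev vermaVector (μ : Module.Dual ℂ (G.deg 0)) : G.Verma μ := G.hwVector G.nonneg μ

/-- The component of degree `n / 2` of `M(μ)`. -/
abbrev vermaDeg (μ : Module.Dual ℂ (G.deg 0)) (n : ℤ) : Submodule ℂ (G.Verma μ) :=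
  G.inducedDeg G.nonneg μ n

/-- The irreducible highest weight module `L(μ)`. -/
abbrev Irr (μ : Module.Dual ℂ (G.deg 0)) : Type u := G.IrrInduced G.nonneg μ

/-- The component of degree `n / 2` of `L(μ)`. -/
abbrev irrDeg (μ : Module.Dual ℂ (G.deg 0)) (n : ℤ) : Submodule ℂ (G.Irr μ) :=
  G.irrInducedDeg G.nonneg μ n

/-- Singular vectors of a `g`-module: non-zero vectors killed by `g₊`. -/
def IsSingular {M : Type v} [AddCommGroup M] [Module g.Env M] (w : M) : Prop :=
  w ≠ 0 ∧ ∀ n : ℤ, 0 < n → ∀ x ∈ G.deg n, g.toEnv x • w = 0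

/-- The functional `μ` vanishes on `g₀ ∩ [p, p]`, so that the generalized Verma module
`M(g, μ, p)` is defined. -/
def VanishesOnDerived (p : Submodule ℂ V) (μ : Module.Dual ℂ (G.deg 0)) : Prop :=
  ∀ h : G.deg 0, (h : V) ∈ Submodule.map₂ g.bracket p p → μ h = 0

/-- `L(μ)` is the irreducible quotient of the generalized Verma module `M(g, μ, p)`: the latter is
defined, and there is an isomorphism of graded `g`-modules from `L(μ)` to its irreducible
quotient. -/
def IsIrrQuotientOfGenVerma (p : Submodule ℂ V) (μ : Module.Dual ℂ (G.deg 0)) : Prop :=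
  G.VanishesOnDerived p μ ∧
    ∃ e : G.Irr μ ≃ₗ[g.Env] G.IrrInduced p μ,
      ∀ n : ℤ, (G.irrDeg μ n).map ((e : G.Irr μ →ₗ[g.Env] G.IrrInduced p μ).restrictScalars ℂ) =
        G.irrInducedDeg p μ n

end HalfIntGrading

end LieSuperalgebra

/-! Let v be the highest weight vector of L(λ), and let F(u) be the coefficient of v_λ in u v_λ, for
u in U(g). The annihilator of v is the largest left ideal inside ker F (`radical`). As F vanishes
off degree 0, this ideal is graded, and U(g)/`radical` is the irreducible quotient of M(λ) and of
any M(g, λ, p) whose defining left ideal lies in `radical` (`ker_irrMk`).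

The homogeneous elements of g acting on v by scalars span a graded subalgebra, `stabilizer`,
containing g₀ ⊕ g₊; λ vanishes on g₀ ∩ [`stabilizer`, `stabilizer`], because commutators of
operators acting on v by scalars kill v (`toEnv_bracket_mem_radical`). For nonzero a of degree -1/2,
the conditions that λ([g_{1/2}, a]) = 0, that a v_λ is singular, and that a v = 0 in L(λ) are all
the same, and they imply pᵃ ⊆ `stabilizer`. This gives the description by M(g, λ, pᵃ), and finite
codimension of pᵃ gives quasifiniteness (`exists_fg_envDeg_le`). Conversely, if L(λ) is quasifinite,
the maps x ↦ x v on the components of g have finite-dimensional images, so `stabilizer` has finite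
codimension in each of them; it meets the infinite-dimensional component of negative degree, hence
is a non-degenerate parabolic subalgebra, and (SP₃) supplies a.

The existence of F and the non-vanishing of a v_λ require that M(λ) be large enough. Instead of a
PBW basis, an action of g on U(g₋) is built by hand (`exists_negAction`), and a small representation
detects the components of U(g₋) of degree 0 and -1/2 (`exists_negRep`). -/

namespace LieSuperalgebra

/-! ### Signs, and U(g) described through homogeneous elements. -/

/-- The sign `(-1)^(α β)` attached to the parities `α` and `β` of the integers `m` and `n`. -/
noncomputable def sgn (m n : ℤ) : ℂ := (-1) ^ ((m : ZMod 2).val * (n : ZMod 2).val)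

lemma sgn_comm (m n : ℤ) : sgn m n = sgn n m := by
  rw [sgn, sgn, mul_comm]

lemma sgn_mul_self (m n : ℤ) : sgn m n * sgn m n = 1 := by
  rw [sgn, ← mul_pow]
  norm_num

lemma sgn_add_left (m n k : ℤ) : sgn (m + n) k = sgn m k * sgn n k := by
  -- Eight cases, checked over ℤ where equality is decidable, then cast to ℂ.
  have h : ∀ α β γ : ZMod 2, (-1 : ℤ) ^ ((α + β).val * γ.val) =
      (-1) ^ (α.val * γ.val) * (-1) ^ (β.val * γ.val) := by decide
  have := congrArg (Int.cast : ℤ → ℂ) (h m n k)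
  push_cast at this
  simpa [sgn] using this

lemma sgn_add_right (m n k : ℤ) : sgn m (n + k) = sgn m n * sgn m k := by
  rw [sgn_comm, sgn_add_left, sgn_comm n, sgn_comm k]

lemma sgn_zero_left (m : ℤ) : sgn 0 m = 1 := by simp [sgn]

/-- Induction over an algebra by multiplying generators on the left. -/
lemma eq_top_of_mul_mem {V B : Type*} [AddCommGroup V] [Module ℂ V] [Ring B] [Algebra ℂ B]
    {j : V → B} (hj : Algebra.adjoin ℂ (Set.range j) = ⊤) (S : Submodule ℂ B) (h1 : (1 : B) ∈ S)
    (hmul : ∀ x, ∀ u ∈ S, j x * u ∈ S) : S = ⊤ := by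
  rw [eq_top_iff]
  rintro b -
  have hb : b ∈ Algebra.adjoin ℂ (Set.range j) := by rw [hj]; trivial
  have key : ∀ u ∈ S, b * u ∈ S := by
    induction hb using Algebra.adjoin_induction with
    | mem x hx => obtain ⟨y, rfl⟩ := hx; exact hmul y
    | algebraMap r => intro u hu; rw [← Algebra.smul_def]; exact S.smul_mem r hu
    | add x y _ _ hx hy => intro u hu; rw [add_mul]; exact S.add_mem (hx u hu) (hy u hu)
    | mul x y _ _ hx hy => intro u hu; rw [mul_assoc]; exact hx _ (hy u hu)
  simpa using key 1 h1

lemma adjoin_range_mkAlgHom_ι {V : Type*} [AddCommGroup V] [Module ℂ V]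
    (r : TensorAlgebra ℂ V → TensorAlgebra ℂ V → Prop) :
    Algebra.adjoin ℂ (Set.range fun x : V => RingQuot.mkAlgHom ℂ r (TensorAlgebra.ι ℂ x)) = ⊤ := by
  have h := congrArg (Subalgebra.map (RingQuot.mkAlgHom ℂ r)) 
    (TensorAlgebra.adjoin_range_ι (R := ℂ) (M := V))
  rw [AlgHom.map_adjoin, Algebra.map_top, (AlgHom.range_eq_top _).2
    (RingQuot.mkAlgHom_surjective ℂ r), ← Set.range_comp] at h
  exact h

variable {V : Type u} [AddCommGroup V] [Module ℂ V] {g : LieSuperalgebra V}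

lemma adjoin_range_toEnv : Algebra.adjoin ℂ (Set.range g.toEnv) = ⊤ :=
  adjoin_range_mkAlgHom_ι _

namespace HalfIntGrading

variable (G : g.HalfIntGrading)

lemma IsConsistent.mem_parity {G : g.HalfIntGrading} (hG : G.IsConsistent) {n : ℤ} {x : V}
    (hx : x ∈ G.deg n) : x ∈ g.parity (n : ZMod 2) := by
  rw [hG]
  exact Submodule.mem_iSup_of_mem n (Submodule.mem_iSup_of_mem rfl hx)

lemma bracket_skew_deg {G : g.HalfIntGrading} (hG : G.IsConsistent) {m n : ℤ} {x y : V}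
    (hx : x ∈ G.deg m) (hy : y ∈ G.deg n) :
    g.bracket x y = -(sgn m n • g.bracket y x) :=
  g.bracket_skew _ _ _ _ (hG.mem_parity hx) (hG.mem_parity hy)

/-- Right bracketing by z is a superderivation: this is the form needed to move x past elements y, z
of g₋ standing to its right. -/
lemma bracket_jacobi_deg {G : g.HalfIntGrading} (hG : G.IsConsistent) {m n k : ℤ} {x y z : V}
    (hx : x ∈ G.deg m) (hy : y ∈ G.deg n) (hz : z ∈ G.deg k) :
    g.bracket (g.bracket x y) z =
      g.bracket x (g.bracket y z) + sgn n k • g.bracket (g.bracket x z) y := by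
  have h1 := g.bracket_jacobi _ _ x y z (hG.mem_parity hx) (hG.mem_parity hy)
  have h2 := bracket_skew_deg hG hy (G.bracket_mem_deg _ _ _ _ hx hz)
  rw [h1, h2]
  change _ = _ + sgn m n • _ + _
  rw [sgn_add_right, sgn_comm n m, smul_neg, smul_smul, ← mul_assoc, sgn_mul_self, one_mul]
  abel

lemma toEnv_bracket {G : g.HalfIntGrading} (hG : G.IsConsistent) {m n : ℤ} {x y : V}
    (hx : x ∈ G.deg m) (hy : y ∈ G.deg n) :
    g.toEnv (g.bracket x y) =
      g.toEnv x * g.toEnv y - sgn m n • (g.toEnv y * g.toEnv x) := by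
  have h := RingQuot.mkAlgHom_rel ℂ (EnvRel.comm (g := g) _ _ x y (hG.mem_parity hx)
    (hG.mem_parity hy))
  rw [map_sub, map_smul, map_mul, map_mul] at h
  exact h.symm

lemma iSup_deg : ⨆ n, G.deg n = ⊤ := G.isInternal_deg.submodule_iSup_eq_top

/-- The linear map on `V` with prescribed restrictions to the homogeneous components. -/
noncomputable def glue {P : Type*} [AddCommMonoid P] [Module ℂ P] (F : ∀ n, G.deg n →ₗ[ℂ] P) :
    V →ₗ[ℂ] P :=
  DirectSum.toModule ℂ ℤ P F ∘ₗ
    (LinearEquiv.ofBijective (DirectSum.coeLinearMap G.deg) G.isInternal_deg).symm.toLinearMap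

lemma glue_apply {P : Type*} [AddCommMonoid P] [Module ℂ P] (F : ∀ n, G.deg n →ₗ[ℂ] P) {n : ℤ}
    {x : V} (hx : x ∈ G.deg n) : G.glue F x = F n ⟨x, hx⟩ := by
  have h : (LinearEquiv.ofBijective (DirectSum.coeLinearMap G.deg) G.isInternal_deg).symm x =
      DirectSum.lof ℂ ℤ (fun n => G.deg n) n ⟨x, hx⟩ := by
    rw [LinearEquiv.symm_apply_eq]
    exact (DirectSum.coeLinearMap_lof G.deg n ⟨x, hx⟩).symm
  rw [glue, LinearMap.comp_apply, LinearEquiv.coe_coe, h, DirectSum.toModule_lof]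

lemma hom_ext_deg {P : Type*} [AddCommMonoid P] [Module ℂ P] {f f' : V →ₗ[ℂ] P}
    (h : ∀ n, ∀ x ∈ G.deg n, f x = f' x) : f = f' := by
  have : (⊤ : Submodule ℂ V) ≤ LinearMap.eqLocus f f' := by
    rw [← G.iSup_deg]
    exact iSup_le h
  ext x
  exact this trivial

/-- The universal property of `U(g)`, checked on homogeneous elements. -/
lemma exists_envHom {G : g.HalfIntGrading} (hG : G.IsConsistent) {B : Type*} [Ring B]
    [Algebra ℂ B] (f : V →ₗ[ℂ] B)
    (hf : ∀ m n, ∀ x ∈ G.deg m, ∀ y ∈ G.deg n,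
      f x * f y - sgn m n • (f y * f x) = f (g.bracket x y)) :
    ∃ F : g.Env →ₐ[ℂ] B, ∀ x, F (g.toEnv x) = f x := by
  have key : ∀ α β : ZMod 2, ∀ a ∈ g.parity α, ∀ b ∈ g.parity β,
      f a * f b - (-1 : ℂ) ^ (α.val * β.val) • (f b * f a) = f (g.bracket a b) := by
    intro α β a ha b hb
    rw [hG] at ha hb
    have hab : ∀ a ∈ ⨆ (n : ℤ) (_ : (n : ZMod 2) = α), G.deg n,
        (⨆ (n : ℤ) (_ : (n : ZMod 2) = β), G.deg n) ≤
        LinearMap.ker (LinearMap.mulLeft ℂ (f a) ∘ₗ f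
          - (-1 : ℂ) ^ (α.val * β.val) • (LinearMap.mulRight ℂ (f a) ∘ₗ f)
          - f ∘ₗ g.bracket a) := by
      intro a ha
      refine iSup_le fun n => iSup_le fun hn y hy => ?_
      have : (⨆ (n : ℤ) (_ : (n : ZMod 2) = α), G.deg n) ≤
        LinearMap.ker (LinearMap.mulRight ℂ (f y) ∘ₗ f
          - (-1 : ℂ) ^ (α.val * β.val) • (LinearMap.mulLeft ℂ (f y) ∘ₗ f)
          - f ∘ₗ g.bracket.flip y) := by
        refine iSup_le fun m => iSup_le fun hm x hx => ?_
        have := hf m n x hx y hy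
        rw [sgn, hm, hn] at this
        simp [this]
      have := this ha
      simpa using this
    have := hab a ha hb
    simpa [sub_eq_zero] using this
  refine ⟨RingQuot.liftAlgHom ℂ ⟨TensorAlgebra.lift ℂ f, ?_⟩, fun x => ?_⟩
  · rintro _ _ ⟨α, β, a, b, ha, hb⟩
    simpa using key α β a ha b hb
  · simp [toEnv]

lemma toEnv_mem_envDeg {n : ℤ} {x : V} (hx : x ∈ G.deg n) : g.toEnv x ∈ G.envDeg n :=
  Submodule.subset_span ⟨[(n, x)], by simpa using hx, by simp, by simp⟩

lemma one_mem_envDeg : (1 : g.Env) ∈ G.envDeg 0 :=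
  Submodule.subset_span ⟨[], by simp, by simp, by simp⟩

lemma mul_mem_envDeg {m n : ℤ} {u w : g.Env} (hu : u ∈ G.envDeg m) (hw : w ∈ G.envDeg n) :
    u * w ∈ G.envDeg (m + n) := by
  have h : G.envDeg m * G.envDeg n ≤ G.envDeg (m + n) := by
    rw [envDeg, envDeg, Submodule.span_mul_span, Submodule.span_le]
    rintro _ ⟨_, ⟨l, hl, rfl, rfl⟩, _, ⟨l', hl', rfl, rfl⟩, rfl⟩
    refine Submodule.subset_span ⟨l ++ l', ?_, by simp, by simp⟩
    intro x hx
    rcases List.mem_append.1 hx with h | h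
    exacts [hl x h, hl' x h]
  exact h (Submodule.mul_mem_mul hu hw)

lemma iSup_envDeg : ⨆ n, G.envDeg n = ⊤ := by
  refine eq_top_of_mul_mem adjoin_range_toEnv _ (Submodule.mem_iSup_of_mem 0 G.one_mem_envDeg) ?_
  intro x u hu
  have hx : x ∈ ⨆ n, G.deg n := by rw [G.iSup_deg]; trivial
  have h1 : (⨆ n, G.deg n) ≤ (⨆ n, G.envDeg n).comap (LinearMap.mulRight ℂ u ∘ₗ g.toEnv) := by
    refine iSup_le fun m x hx => ?_
    have h2 : (⨆ n, G.envDeg n) ≤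
        (⨆ n, G.envDeg n).comap (LinearMap.mulLeft ℂ (g.toEnv x)) := by
      refine iSup_le fun n w hw => ?_
      exact Submodule.mem_iSup_of_mem (m + n) (G.mul_mem_envDeg (G.toEnv_mem_envDeg hx) hw)
    exact h2 hu
  exact h1 hx

end HalfIntGrading

end LieSuperalgebra

/-! ### Realization of the Verma module on U(g₋). -/

namespace LieSuperalgebra

namespace HalfIntGrading

variable {V : Type u} [AddCommGroup V] [Module ℂ V] {g : LieSuperalgebra V}
variable (G : g.HalfIntGrading)

/-- Defining relations of the enveloping algebra of `g₋`, on the generating space `V`: the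
components of non-negative degree are sent to zero. -/
inductive NegRel : TensorAlgebra ℂ V → TensorAlgebra ℂ V → Prop
  | comm (m n : ℤ) (hm : m < 0) (hn : n < 0) (a b : V) (ha : a ∈ G.deg m) (hb : b ∈ G.deg n) :
      NegRel
        (TensorAlgebra.ι ℂ a * TensorAlgebra.ι ℂ b
          - sgn m n • (TensorAlgebra.ι ℂ b * TensorAlgebra.ι ℂ a))
        (TensorAlgebra.ι ℂ (g.bracket a b))
  | zero (n : ℤ) (hn : 0 ≤ n) (a : V) (ha : a ∈ G.deg n) : NegRel (TensorAlgebra.ι ℂ a) 0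

/-- The enveloping algebra of `g₋`. -/
def NegEnv : Type u := RingQuot G.NegRel

noncomputable instance : Ring G.NegEnv := inferInstanceAs (Ring (RingQuot G.NegRel))

noncomputable instance : Algebra ℂ G.NegEnv := inferInstanceAs (Algebra ℂ (RingQuot G.NegRel))

/-- The quotient map to the enveloping algebra of `g₋`. -/
noncomputable def negMk : TensorAlgebra ℂ V →ₐ[ℂ] G.NegEnv := RingQuot.mkAlgHom ℂ G.NegRel

/-- The map from `g` to the enveloping algebra of `g₋`, zero on `g₀ ⊕ g₊`. -/
noncomputable def toNeg : V →ₗ[ℂ] G.NegEnv := G.negMk.toLinearMap ∘ₗ TensorAlgebra.ι ℂ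

lemma adjoin_range_toNeg : Algebra.adjoin ℂ (Set.range G.toNeg) = ⊤ :=
  adjoin_range_mkAlgHom_ι _

lemma negMk_rel {x y : TensorAlgebra ℂ V} (h : G.NegRel x y) : G.negMk x = G.negMk y :=
  RingQuot.mkAlgHom_rel ℂ h

variable {G}

lemma toNeg_of_nonneg {n : ℤ} (hn : 0 ≤ n) {x : V} (hx : x ∈ G.deg n) : G.toNeg x = 0 := by
  have h := G.negMk_rel (NegRel.zero n hn x hx)
  rw [map_zero] at h
  exact h

lemma toNeg_bracket {m n : ℤ} (hm : m < 0) (hn : n < 0) {x y : V} (hx : x ∈ G.deg m)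
    (hy : y ∈ G.deg n) :
    G.toNeg (g.bracket x y) =
      G.toNeg x * G.toNeg y - sgn m n • (G.toNeg y * G.toNeg x) := by
  have h := G.negMk_rel (NegRel.comm m n hm hn x y hx hy)
  rw [map_sub, map_smul, map_mul, map_mul] at h
  exact h.symm

lemma exists_negHom {B : Type*} [Ring B] [Algebra ℂ B] (f : V →ₗ[ℂ] B)
    (hf : ∀ m n, m < 0 → n < 0 → ∀ x ∈ G.deg m, ∀ y ∈ G.deg n,
      f x * f y - sgn m n • (f y * f x) = f (g.bracket x y))
    (hf0 : ∀ n, 0 ≤ n → ∀ x ∈ G.deg n, f x = 0) :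
    ∃ F : G.NegEnv →ₐ[ℂ] B, ∀ x, F (G.toNeg x) = f x := by
  have h : ∀ ⦃x y⦄, G.NegRel x y → TensorAlgebra.lift ℂ f x = TensorAlgebra.lift ℂ f y := by
    rintro _ _ (⟨m, n, hm, hn, a, b, ha, hb⟩ | ⟨n, hn, a, ha⟩)
    · simpa using hf m n hm hn a ha b hb
    · simpa using hf0 n hn a ha
  refine ⟨RingQuot.liftAlgHom ℂ ⟨TensorAlgebra.lift ℂ f, h⟩, fun x => ?_⟩
  exact (RingQuot.liftAlgHom_mkAlgHom_apply ℂ _ h _).trans (TensorAlgebra.lift_ι_apply f x)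

variable (G)

/-- The projection to `g₀ ⊕ g₊`. -/
noncomputable def nonnegProj : V →ₗ[ℂ] V :=
  G.glue fun n => if 0 ≤ n then (G.deg n).subtype else 0

/-- The map `x ↦ (-1)^(α β) x` for `x` of parity `α`, where `β` is the parity of `n`. -/
noncomputable def twist (n : ℤ) : V →ₗ[ℂ] V := G.glue fun m => sgn m n • (G.deg m).subtype

variable {G}

lemma nonnegProj_of_nonneg {n : ℤ} (hn : 0 ≤ n) {x : V} (hx : x ∈ G.deg n) :
    G.nonnegProj x = x := by
  rw [nonnegProj, glue_apply _ _ hx, if_pos hn, Submodule.subtype_apply]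

lemma nonnegProj_of_neg {n : ℤ} (hn : n < 0) {x : V} (hx : x ∈ G.deg n) :
    G.nonnegProj x = 0 := by
  rw [nonnegProj, glue_apply _ _ hx, if_neg hn.not_ge, LinearMap.zero_apply]

lemma twist_apply {m : ℤ} (n : ℤ) {x : V} (hx : x ∈ G.deg m) : G.twist n x = sgn m n • x := by
  rw [twist, glue_apply _ _ hx, LinearMap.smul_apply, Submodule.subtype_apply]

variable (G)

/-- Pairs of a linear map from `g₀ ⊕ g₊` (extended to `g`) and an element of `U(g₋)`. -/
abbrev ActionPair : Type u := (V →ₗ[ℂ] G.NegEnv) × G.NegEnv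

/-- The action of a pair `(φ, t)`: `φ` on `g₀ ⊕ g₊`, right multiplication by `t` on `g₋`. -/
noncomputable def pairing (w : G.ActionPair) : V →ₗ[ℂ] G.NegEnv :=
  w.1 ∘ₗ G.nonnegProj + LinearMap.mulRight ℂ w.2 ∘ₗ G.toNeg

/-- Left multiplication by `y`, of the parity of `n`, on pairs. -/
noncomputable def pairMulAux (n : ℤ) : V →ₗ[ℂ] Module.End ℂ G.ActionPair :=
  LinearMap.mk₂ ℂ (fun y w =>
    ((LinearMap.mulLeft ℂ (G.toNeg y) ∘ₗ w.1 ∘ₗ G.twist n + G.pairing w ∘ₗ g.bracket.flip y) ∘ₗ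
      G.nonnegProj, G.toNeg y * w.2))
    (by intros; ext <;> simp [pairing, add_mul]; abel)
    (by intros; ext <;> simp [pairing])
    (by intros; ext <;> simp [pairing, mul_add]; abel)
    (by intros; ext <;> simp [pairing])

/-- Left multiplication by elements of `g₋` on pairs. -/
noncomputable def pairMul : V →ₗ[ℂ] Module.End ℂ G.ActionPair :=
  G.glue fun n => if n < 0 then G.pairMulAux n ∘ₗ (G.deg n).subtype else 0

variable {G}

lemma pairMul_of_nonneg {n : ℤ} (hn : 0 ≤ n) {y : V} (hy : y ∈ G.deg n) : G.pairMul y = 0 := by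
  rw [pairMul, glue_apply _ _ hy, if_neg hn.not_gt, LinearMap.zero_apply]

lemma pairMul_of_neg {n : ℤ} (hn : n < 0) {y : V} (hy : y ∈ G.deg n) (w : G.ActionPair) :
    G.pairMul y w =
      ((LinearMap.mulLeft ℂ (G.toNeg y) ∘ₗ w.1 ∘ₗ G.twist n + G.pairing w ∘ₗ g.bracket.flip y) ∘ₗ
      G.nonnegProj, G.toNeg y * w.2) := by
  rw [pairMul, glue_apply _ _ hy, if_pos hn]
  rfl

lemma pairing_of_nonneg {n : ℤ} (hn : 0 ≤ n) {x : V} (hx : x ∈ G.deg n) (w : G.ActionPair) :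
    G.pairing w x = w.1 x := by
  simp [pairing, nonnegProj_of_nonneg hn hx, toNeg_of_nonneg hn hx]

lemma pairing_of_neg {n : ℤ} (hn : n < 0) {x : V} (hx : x ∈ G.deg n) (w : G.ActionPair) :
    G.pairing w x = G.toNeg x * w.2 := by
  simp [pairing, nonnegProj_of_neg hn hx]

/-- A pair encodes a vector u by the values x u for x in g₀ ⊕ g₊, together with u itself. The rule
is x(yu) = ± y(xu) + [x, y]u: for x of non-negative degree it defines `pairMul`, for x in g₋ it is
the relation of U(g₋). -/
lemma pairing_pairMul {m n : ℤ} (hn : n < 0) {x y : V} (hx : x ∈ G.deg m) (hy : y ∈ G.deg n)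
    (w : G.ActionPair) :
    G.pairing (G.pairMul y w) x =
      sgn m n • (G.toNeg y * G.pairing w x) + G.pairing w (g.bracket x y) := by
  rcases lt_or_ge m 0 with hm | hm
  · rw [pairing_of_neg hm hx, pairing_of_neg hm hx,
      pairing_of_neg (add_neg hm hn) (G.bracket_mem_deg _ _ _ _ hx hy), toNeg_bracket hm hn hx hy,
      pairMul_of_neg hn hy]
    simp [sub_mul, mul_assoc]
  · rw [pairing_of_nonneg hm hx, pairing_of_nonneg hm hx, pairMul_of_neg hn hy]
    simp [nonnegProj_of_nonneg hm hx, twist_apply n hx]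

lemma pairing_add_left (w w' : G.ActionPair) : G.pairing (w + w') = G.pairing w + G.pairing w' := by
  ext x
  simp [pairing, mul_add]
  abel

lemma pairing_smul_left (c : ℂ) (w : G.ActionPair) : G.pairing (c • w) = c • G.pairing w := by
  ext x
  simp [pairing]

/-- The relations of U(g₋) hold for `pairMul`, so U(g₋) acts on pairs. In the first component,
moving x past y and z in both orders leaves the Jacobi identity for x, y, z. -/
lemma pairMul_comm (hG : G.IsConsistent) {n k : ℤ} (hn : n < 0) (hk : k < 0) {y z : V}
    (hy : y ∈ G.deg n) (hz : z ∈ G.deg k) :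
    G.pairMul y * G.pairMul z - sgn n k • (G.pairMul z * G.pairMul y) =
      G.pairMul (g.bracket y z) := by
  have hyz := G.bracket_mem_deg _ _ _ _ hy hz
  refine LinearMap.ext fun w => Prod.ext ?_ ?_
  · refine G.hom_ext_deg fun m x hx => ?_
    rcases lt_or_ge m 0 with hm | hm
    · simp [pairMul_of_neg hn hy, pairMul_of_neg hk hz, pairMul_of_neg (add_neg hn hk) hyz,
        nonnegProj_of_neg hm hx]
    · have e : ∀ w : G.ActionPair, w.1 x = G.pairing w x :=
        fun w => (pairing_of_nonneg hm hx w).symm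
      have hxy := G.bracket_mem_deg _ _ _ _ hx hy
      have hxz := G.bracket_mem_deg _ _ _ _ hx hz
      rw [e, e, LinearMap.sub_apply, LinearMap.smul_apply, Module.End.mul_apply,
        Module.End.mul_apply, sub_eq_add_neg, ← neg_smul, pairing_add_left, pairing_smul_left,
        LinearMap.add_apply, LinearMap.smul_apply, pairing_pairMul hn hx hy,
        pairing_pairMul hk hx hz, pairing_pairMul hk hxy hz, pairing_pairMul hk hx hz,
        pairing_pairMul hn hx hy, pairing_pairMul hn hxz hy, pairing_pairMul (add_neg hn hk) hx hyz,
        bracket_jacobi_deg hG hx hy hz, toNeg_bracket hn hk hy hz]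
      have h1 : sgn n k * sgn k n = 1 := by rw [sgn_comm k n, sgn_mul_self]
      simp only [mul_add, sub_mul, smul_add, smul_sub, mul_smul_comm, smul_mul_assoc, smul_smul,
        mul_assoc, map_add, map_smul, sgn_add_left, sgn_add_right]
      have h2 : -sgn n k * (sgn m n * sgn k n) = - sgn m n := by linear_combination (-sgn m n) * h1
      rw [h2]
      module
  · simp [pairMul_of_neg hn hy, pairMul_of_neg hk hz, pairMul_of_neg (add_neg hn hk) hyz,
      toNeg_bracket hn hk hy hz, sub_mul, mul_assoc]

variable (G) in
/-- The functional on `g` that is `μ` on `g₀` and zero on the other components. -/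
noncomputable def extendWeight (μ : Module.Dual ℂ (G.deg 0)) : V →ₗ[ℂ] ℂ :=
  G.glue fun n => if h : n = 0 then μ ∘ₗ (LinearEquiv.ofEq _ _ (congrArg G.deg h)).toLinearMap
    else 0

lemma extendWeight_zero (μ : Module.Dual ℂ (G.deg 0)) (h : G.deg 0) :
    G.extendWeight μ h = μ h := by
  rw [extendWeight, glue_apply _ _ h.2, dif_pos rfl]
  rfl

lemma extendWeight_of_ne (μ : Module.Dual ℂ (G.deg 0)) {n : ℤ} (hn : n ≠ 0) {x : V}
    (hx : x ∈ G.deg n) : G.extendWeight μ x = 0 := by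
  rw [extendWeight, glue_apply _ _ hx, dif_neg hn, LinearMap.zero_apply]

lemma NegEnv.eq_top {S : Submodule ℂ G.NegEnv} (h1 : (1 : G.NegEnv) ∈ S)
    (hmul : ∀ n < 0, ∀ y ∈ G.deg n, ∀ u ∈ S, G.toNeg y * u ∈ S) : S = ⊤ := by
  refine eq_top_of_mul_mem G.adjoin_range_toNeg S h1 fun x u hu => ?_
  have : (⨆ n, G.deg n) ≤ S.comap (LinearMap.mulRight ℂ u ∘ₗ G.toNeg) := by
    refine iSup_le fun n y hy => ?_
    rcases lt_or_ge n 0 with hn | hn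
    · exact hmul n hn y hy u hu
    · simp [toNeg_of_nonneg hn hy]
  rw [G.iSup_deg] at this
  exact this (x := x) trivial

/-- The Verma module of highest weight `μ`, realized on `U(g₋)`. -/
lemma exists_negAction (hG : G.IsConsistent) (h1 : G.SP1) (μ : Module.Dual ℂ (G.deg 0)) :
    ∃ ψ : g.Env →ₐ[ℂ] Module.End ℂ G.NegEnv,
      (∀ n < 0, ∀ y ∈ G.deg n, ∀ u, ψ (g.toEnv y) u = G.toNeg y * u) ∧
      (∀ n, 0 ≤ n → ∀ x ∈ G.deg n,
        ψ (g.toEnv x) 1 = algebraMap ℂ G.NegEnv (G.extendWeight μ x)) := by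
  obtain ⟨Φ, hΦ⟩ := exists_negHom (B := Module.End ℂ G.ActionPair) G.pairMul
    (fun m n hm hn x hx y hy => pairMul_comm hG hm hn hx hy) fun n hn x hx => pairMul_of_nonneg hn hx
  -- The pair of the highest weight vector 1. Applying u to it yields the pair of u, whose first
  -- component then defines the action of g₀ ⊕ g₊ on u.
  let w₀ : G.ActionPair := ((Algebra.linearMap ℂ G.NegEnv) ∘ₗ G.extendWeight μ, 1)
  have hsnd : ∀ u, (Φ u w₀).2 = u := by
    have : LinearMap.eqLocus (LinearMap.snd ℂ _ _ ∘ₗ LinearMap.applyₗ w₀ ∘ₗ Φ.toLinearMap)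
        (LinearMap.id : G.NegEnv →ₗ[ℂ] G.NegEnv) = ⊤ := by
      refine NegEnv.eq_top (by simp [w₀]) fun n hn y hy u hu => ?_
      simp only [LinearMap.mem_eqLocus, LinearMap.comp_apply, AlgHom.toLinearMap_apply,
        LinearMap.applyₗ_apply_apply, LinearMap.snd_apply, LinearMap.id_apply] at hu ⊢
      rw [map_mul, hΦ, Module.End.mul_apply, pairMul_of_neg hn hy, hu]
    intro u
    exact (this.symm ▸ trivial : u ∈ LinearMap.eqLocus (LinearMap.snd ℂ _ _ ∘ₗ
      LinearMap.applyₗ w₀ ∘ₗ Φ.toLinearMap) (LinearMap.id : G.NegEnv →ₗ[ℂ] G.NegEnv))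
  let ρ : V →ₗ[ℂ] Module.End ℂ G.NegEnv := LinearMap.mk₂ ℂ (fun x u => G.pairing (Φ u w₀) x)
    (by intros; simp) (by intros; simp)
    (by intros; simp [pairing_add_left]) (by intros; simp [pairing_smul_left])
  have hρ : ∀ x u, ρ x u = G.pairing (Φ u w₀) x := fun _ _ => rfl
  have hneg : ∀ n < 0, ∀ y ∈ G.deg n, ∀ u, ρ y u = G.toNeg y * u := by
    intro n hn y hy u
    rw [hρ, pairing_of_neg hn hy, hsnd]
  have hone : ∀ n, 0 ≤ n → ∀ x ∈ G.deg n,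
      ρ x 1 = algebraMap ℂ G.NegEnv (G.extendWeight μ x) := by
    intro n hn x hx
    rw [hρ, pairing_of_nonneg hn hx]
    simp [w₀]
  have hrec : ∀ m n, n < 0 → ∀ x ∈ G.deg m, ∀ y ∈ G.deg n, ∀ u,
      ρ x (G.toNeg y * u) = sgn m n • (G.toNeg y * ρ x u) + ρ (g.bracket x y) u := by
    intro m n hn x hx y hy u
    rw [hρ, map_mul, hΦ, Module.End.mul_apply, pairing_pairMul hn hx hy]
    rfl
  have hcomm : ∀ u m n, ∀ x ∈ G.deg m, ∀ y ∈ G.deg n,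
      ρ x (ρ y u) - sgn m n • ρ y (ρ x u) = ρ (g.bracket x y) u := by
    -- If one of the two elements lies in g₋, the commutation relation is the recursion `hrec`, up
    -- to skew-symmetry. Otherwise it is proved by induction on u.
    have hn : ∀ m n, n < 0 → ∀ x ∈ G.deg m, ∀ y ∈ G.deg n, ∀ u,
        ρ x (ρ y u) - sgn m n • ρ y (ρ x u) = ρ (g.bracket x y) u := by
      intro m n hn x hx y hy u
      rw [hneg n hn y hy, hrec m n hn x hx y hy, hneg n hn y hy]
      abel
    have hm : ∀ m n, m < 0 → ∀ x ∈ G.deg m, ∀ y ∈ G.deg n, ∀ u,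
        ρ x (ρ y u) - sgn m n • ρ y (ρ x u) = ρ (g.bracket x y) u := by
      intro m n hm x hx y hy u
      have := hn n m hm y hy x hx u
      rw [bracket_skew_deg hG hx hy, map_neg, map_smul, LinearMap.neg_apply, LinearMap.smul_apply,
        ← this, smul_sub, smul_smul, sgn_comm n m, sgn_mul_self, one_smul]
      abel
    let S : Submodule ℂ G.NegEnv := ⨅ m, ⨅ n, ⨅ x : G.deg m, ⨅ y : G.deg n,
      LinearMap.ker (ρ x * ρ y - sgn m n • (ρ y * ρ x) - ρ (g.bracket x y))
    have hS : ∀ u, u ∈ S ↔ ∀ m n, ∀ x ∈ G.deg m, ∀ y ∈ G.deg n,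
        ρ x (ρ y u) - sgn m n • ρ y (ρ x u) = ρ (g.bracket x y) u := by
      intro u
      simp [S, sub_eq_zero]
    have : S = ⊤ := by
      refine NegEnv.eq_top ?_ ?_
      · rw [hS]
        intro m n x hx y hy
        rcases lt_or_ge m 0 with hm0 | hm0
        · exact hm m n hm0 x hx y hy 1
        rcases lt_or_ge n 0 with hn0 | hn0
        · exact hn m n hn0 x hx y hy 1
        -- On the vector 1, both elements act by `extendWeight`. The bracket has positive degree
        -- unless m = n = 0, and then commutativity of g₀ makes it zero.
        rw [hone n hn0 y hy, hone m hm0 x hx, hone _ (add_nonneg hm0 hn0) _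
          (G.bracket_mem_deg _ _ _ _ hx hy), Algebra.algebraMap_eq_smul_one,
          Algebra.algebraMap_eq_smul_one, map_smul, map_smul, hone n hn0 y hy, hone m hm0 x hx]
        rcases eq_or_ne m 0 with rfl | hm1
        · rcases eq_or_ne n 0 with rfl | hn1
          · rw [h1 x hx y hy, sgn_zero_left]
            simp only [Algebra.algebraMap_eq_smul_one, map_zero]
            module
          · rw [extendWeight_of_ne μ hn1 hy, extendWeight_of_ne μ (by simpa using hn1)
              (G.bracket_mem_deg _ _ _ _ hx hy)]
            simp
        · rw [extendWeight_of_ne μ hm1 hx, extendWeight_of_ne μ (by omega)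
            (G.bracket_mem_deg _ _ _ _ hx hy)]
          simp
      · intro k hk z hz u hu
        rw [hS] at hu ⊢
        intro m n x hx y hy
        have hxz := G.bracket_mem_deg _ _ _ _ hx hz
        have hyz := G.bracket_mem_deg _ _ _ _ hy hz
        have hxy := G.bracket_mem_deg _ _ _ _ hx hy
        have j1 := hu m n x hx y hy
        have j2 := hu _ n _ hxz y hy
        have j3 := hu m _ x hx _ hyz
        have hJ := congrArg (fun v => ρ v u) (bracket_jacobi_deg hG hx hy hz)
        simp only [map_add, map_smul, LinearMap.add_apply, LinearMap.smul_apply] at hJ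
        rw [hrec n k hk y hy z hz, hrec m k hk x hx z hz, hrec _ k hk _ hxy z hz, hJ, ← j1, ← j2,
          ← j3]
        simp only [map_add, map_smul, hrec m k hk x hx z hz, hrec n k hk y hy z hz, sgn_add_left,
          sgn_add_right, smul_add, smul_sub, mul_sub, mul_smul_comm, smul_smul]
        have e1 : sgn n k * (sgn m n * sgn k n) = sgn m n := by
          rw [sgn_comm k n]; linear_combination sgn m n * sgn_mul_self n k
        rw [e1]
        module
    intro u
    exact (hS u).1 (this ▸ trivial)
  obtain ⟨ψ, hψ⟩ := exists_envHom hG ρ (fun m n x hx y hy => LinearMap.ext fun u => by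
    simpa using hcomm u m n x hx y hy)
  exact ⟨ψ, fun n hn y hy u => by rw [hψ, hneg n hn y hy],
    fun n hn x hx => by rw [hψ, hone n hn x hx]⟩

/-- A representation of `U(g₋)` that separates the elements of degree `0` and `-1/2`. -/
lemma exists_negRep : ∃ θ : G.NegEnv →ₐ[ℂ] Module.End ℂ (ℂ × V),
    (∀ y p, (θ (G.toNeg y) p).1 = 0) ∧ ∀ a ∈ G.deg (-1), θ (G.toNeg a) (1, 0) = (0, a) := by
  -- Brackets inside g₋ have degree at most -1 and are killed by π, while any two of the operators
  -- `f y` have product zero; so the relations of U(g₋) read 0 = 0.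
  let π : V →ₗ[ℂ] V := G.glue fun n => if n = -1 then (G.deg n).subtype else 0
  have hπ : ∀ n, n ≠ -1 → ∀ x ∈ G.deg n, π x = 0 := fun n hn x hx => by
    simp only [π]
    rw [glue_apply _ _ hx, if_neg hn, LinearMap.zero_apply]
  have hπ1 : ∀ x ∈ G.deg (-1), π x = x := fun x hx => by
    simp only [π]
    rw [glue_apply _ _ hx, if_pos rfl, Submodule.subtype_apply]
  let f : V →ₗ[ℂ] Module.End ℂ (ℂ × V) :=
    LinearMap.mk₂ ℂ (fun y p => (0, p.1 • π y)) (by intros; ext <;> simp) (by intros; ext <;> simp [smul_smul, mul_comm])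
      (by intros; ext <;> simp [add_smul]) (by intros; ext <;> simp [smul_smul])
  have hf : ∀ y p, f y p = (0, p.1 • π y) := fun _ _ => rfl
  obtain ⟨θ, hθ⟩ := exists_negHom (G := G) f
    (fun m n hm hn x hx y hy => by
      refine LinearMap.ext fun p => ?_
      ext <;> simp [hf, hπ _ (show m + n ≠ -1 by omega) _ (G.bracket_mem_deg _ _ _ _ hx hy)])
    (fun n hn x hx => by
      refine LinearMap.ext fun p => ?_
      ext <;> simp [hf, hπ _ (show n ≠ -1 by omega) _ hx])
  refine ⟨θ, fun y p => by rw [hθ, hf], fun a ha => ?_⟩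
  rw [hθ, hf, hπ1 a ha, one_smul]

end HalfIntGrading

end LieSuperalgebra

/-! ### Submodules generated by words in g₋. -/

namespace LieSuperalgebra

namespace HalfIntGrading

variable {V : Type u} [AddCommGroup V] [Module ℂ V] {g : LieSuperalgebra V}
variable (G : g.HalfIntGrading)

section Words

variable {M : Type*} [AddCommGroup M] [Module ℂ M]

/-- The span of the vectors `y₁ ⋯ yₖ e`, where `e ∈ E` and the `yᵢ` are homogeneous of negative
degree, of total degree `n / 2`. -/
def negWords (ψ : g.Env →ₐ[ℂ] Module.End ℂ M) (E : Submodule ℂ M) (n : ℤ) : Submodule ℂ M :=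
  Submodule.span ℂ {w | ∃ l : List (ℤ × V), (∀ x ∈ l, x.1 < 0 ∧ x.2 ∈ G.deg x.1) ∧
    (l.map Prod.fst).sum = n ∧ ∃ e ∈ E, w = ψ (l.map fun x => g.toEnv x.2).prod e}

variable {G} {ψ : g.Env →ₐ[ℂ] Module.End ℂ M} {E : Submodule ℂ M}

lemma neg_apply_mem_negWords {m n : ℤ} (hm : m < 0) {y : V} (hy : y ∈ G.deg m) {w : M}
    (hw : w ∈ G.negWords ψ E n) : ψ (g.toEnv y) w ∈ G.negWords ψ E (m + n) := by
  have : G.negWords ψ E n ≤ (G.negWords ψ E (m + n)).comap (ψ (g.toEnv y)) := by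
    rw [negWords, Submodule.span_le]
    rintro _ ⟨l, hl, rfl, e, he, rfl⟩
    refine Submodule.subset_span ⟨(m, y) :: l, ?_, by simp, e, he, by simp⟩
    rintro x (_ | ⟨_, hx⟩)
    exacts [⟨hm, hy⟩, hl x hx]
  exact this hw

/-- Move x to the right through the word. Each commutator [x, y] is again homogeneous but of another
degree, possibly negative, so the induction on the word runs over all x and m at once. -/
lemma apply_mem_negWords (hG : G.IsConsistent)
    (hpos : ∀ n, 0 < n → ∀ x ∈ G.deg n, ∀ e ∈ E, ψ (g.toEnv x) e = 0)
    (hzero : ∀ x ∈ G.deg 0, ∀ e ∈ E, ψ (g.toEnv x) e ∈ E)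
    {m n : ℤ} {x : V} (hx : x ∈ G.deg m) {w : M} (hw : w ∈ G.negWords ψ E n) :
    ψ (g.toEnv x) w ∈ G.negWords ψ E (m + n) := by
  have key : ∀ l : List (ℤ × V), (∀ x ∈ l, x.1 < 0 ∧ x.2 ∈ G.deg x.1) → ∀ e ∈ E, ∀ m, ∀ x ∈ G.deg m,
      ψ (g.toEnv x) (ψ (l.map fun x => g.toEnv x.2).prod e) ∈
        G.negWords ψ E (m + (l.map Prod.fst).sum) := by
    intro l
    induction l with
    | nil =>
      intro _ e he m x hx
      rcases lt_trichotomy m 0 with hm | rfl | hm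
      · exact neg_apply_mem_negWords hm hx (Submodule.subset_span ⟨[], by simp, by simp, e, he, rfl⟩)
      · exact Submodule.subset_span ⟨[], by simp, by simp, _, hzero x hx e he, by simp⟩
      · have := hpos m hm x hx e he
        simp [this]
    | cons y l ih =>
      intro hl e he m x hx
      obtain ⟨n, y⟩ := y
      obtain ⟨⟨hn, hy⟩, hl⟩ := List.forall_mem_cons.1 hl
      have h := congrArg (fun u => ψ u (ψ (l.map fun x => g.toEnv x.2).prod e))
        (toEnv_bracket hG hx hy)
      simp only [map_sub, map_smul, map_mul, LinearMap.sub_apply, LinearMap.smul_apply,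
        Module.End.mul_apply] at h
      simp only [List.map_cons, List.prod_cons, List.sum_cons, map_mul, Module.End.mul_apply]
      rw [sub_eq_iff_eq_add.1 h.symm]
      refine add_mem ?_ (Submodule.smul_mem _ _ ?_)
      · rw [← add_assoc]
        exact ih hl e he _ _ (G.bracket_mem_deg _ _ _ _ hx hy)
      · rw [add_left_comm]
        exact neg_apply_mem_negWords hn hy (ih hl e he m x hx)
  have : G.negWords ψ E n ≤ (G.negWords ψ E (m + n)).comap (ψ (g.toEnv x)) := by
    conv_lhs => rw [negWords]
    rw [Submodule.span_le]
    rintro _ ⟨l, hl, rfl, e, he, rfl⟩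
    exact key l hl e he m x hx
  exact this hw

/-- The part of PBW that is needed: U(g)E = U(g₋)E, degree by degree, when g₊ kills E and g₀
preserves it. -/
lemma envDeg_apply_mem_negWords (hG : G.IsConsistent)
    (hpos : ∀ n, 0 < n → ∀ x ∈ G.deg n, ∀ e ∈ E, ψ (g.toEnv x) e = 0)
    (hzero : ∀ x ∈ G.deg 0, ∀ e ∈ E, ψ (g.toEnv x) e ∈ E)
    {n : ℤ} {u : g.Env} (hu : u ∈ G.envDeg n) {e : M} (he : e ∈ E) :
    ψ u e ∈ G.negWords ψ E n := by
  have : G.envDeg n ≤ (G.negWords ψ E n).comap (LinearMap.applyₗ e ∘ₗ ψ.toLinearMap) := by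
    rw [envDeg, Submodule.span_le]
    rintro _ ⟨l, hl, rfl, rfl⟩
    clear hu
    simp only [SetLike.mem_coe, Submodule.mem_comap, LinearMap.comp_apply,
      AlgHom.toLinearMap_apply, LinearMap.applyₗ_apply_apply]
    induction l with
    | nil => exact Submodule.subset_span ⟨[], by simp, by simp, e, he, by simp⟩
    | cons y l ih =>
      obtain ⟨hy, hl⟩ := List.forall_mem_cons.1 hl
      simp only [List.map_cons, List.prod_cons, List.sum_cons, map_mul, Module.End.mul_apply]
      exact apply_mem_negWords hG hpos hzero hy (ih hl)
  exact this hu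

lemma sum_fst_nonpos {l : List (ℤ × V)} (hl : ∀ x ∈ l, x.1 < 0 ∧ x.2 ∈ G.deg x.1) :
    (l.map Prod.fst).sum ≤ 0 := by
  induction l with
  | nil => simp
  | cons y l ih =>
    obtain ⟨hy, hl⟩ := List.forall_mem_cons.1 hl
    rw [List.map_cons, List.sum_cons]
    exact add_nonpos hy.1.le (ih hl)

lemma negWords_of_pos {n : ℤ} (hn : 0 < n) : G.negWords ψ E n = ⊥ := by
  rw [negWords, Submodule.span_eq_bot]
  rintro _ ⟨l, hl, hs, -⟩
  have := sum_fst_nonpos hl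
  omega

lemma negWords_zero_le : G.negWords ψ E 0 ≤ E := by
  rw [negWords, Submodule.span_le]
  rintro _ ⟨l, hl, hs, e, he, rfl⟩
  cases l with
  | nil => simpa using he
  | cons y l =>
    obtain ⟨hy, hl⟩ := List.forall_mem_cons.1 hl
    have := sum_fst_nonpos hl
    rw [List.map_cons, List.sum_cons] at hs
    omega

end Words

/-! ### The projection to the highest weight line. -/

variable {G}

lemma eq_zero_of_mem_nonneg {n : ℤ} (hn : n < 0) {x : V} (hx : x ∈ G.nonneg) (hx' : x ∈ G.deg n) :
    x = 0 := by
  have : G.nonneg ≤ LinearMap.eqLocus G.nonnegProj LinearMap.id :=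
    iSup_le fun m => iSup_le fun hm y hy => nonnegProj_of_nonneg hm hy
  have h : G.nonnegProj x = x := this hx
  rw [← h, nonnegProj_of_neg hn hx']

lemma toEnv_mem_weightIdeal {n : ℤ} (hn : n ≠ 0) {p : Submodule ℂ V} {μ : Module.Dual ℂ (G.deg 0)}
    {x : V} (hx : x ∈ p) (hx' : x ∈ G.deg n) : g.toEnv x ∈ G.weightIdeal p μ :=
  Submodule.subset_span (Or.inr ⟨n, hn, x, ⟨hx, hx'⟩, rfl⟩)

lemma toEnv_sub_mem_weightIdeal (p : Submodule ℂ V) (μ : Module.Dual ℂ (G.deg 0)) (h : G.deg 0) :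
    g.toEnv (h : V) - algebraMap ℂ g.Env (μ h) ∈ G.weightIdeal p μ :=
  Submodule.subset_span (Or.inl ⟨h, rfl⟩)

lemma deg_le_nonneg {n : ℤ} (hn : 0 ≤ n) : G.deg n ≤ G.nonneg :=
  le_iSup₂_of_le (f := fun (n : ℤ) (_ : 0 ≤ n) => G.deg n) n hn le_rfl

variable (G) in
/-- The projection of `U(g)` to the highest weight line of `M(μ)`, with the properties that result
from the realization of `M(μ)` on `U(g₋)`. -/
structure WeightFunctional (μ : Module.Dual ℂ (G.deg 0)) where
  toFun : g.Env →ₗ[ℂ] ℂ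
  map_one : toFun 1 = 1
  map_deg : ∀ n ≠ 0, ∀ u ∈ G.envDeg n, toFun u = 0
  map_ideal : ∀ u ∈ G.weightIdeal G.nonneg μ, toFun u = 0
  map_mul_toEnv : ∀ a ∈ G.deg (-1),
    (∀ h : G.deg 0, (∃ x ∈ G.deg 1, g.bracket x a = (h : V)) → μ h = 0) →
    ∀ w, toFun (w * g.toEnv a) = 0

/-- The functional applies u to the vector 1 of U(g₋), then takes the augmentation, read off as the
first coordinate of `θ` at (1, 0). Non-empty words in g₋ lie in the augmentation ideal, whence
vanishing off degree 0. -/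
lemma exists_weightFunctional (hG : G.IsConsistent) (h1 : G.SP1) (μ : Module.Dual ℂ (G.deg 0)) :
    Nonempty (G.WeightFunctional μ) ∧
      ∀ a ∈ G.deg (-1), g.toEnv a ∈ G.weightIdeal G.nonneg μ → a = 0 := by
  obtain ⟨ψ, hneg, hone⟩ := exists_negAction hG h1 μ
  obtain ⟨θ, hθ, hθ1⟩ := exists_negRep (G := G)
  have hideal : ∀ u ∈ G.weightIdeal G.nonneg μ, ψ u 1 = 0 := by
    intro u hu
    induction hu using Submodule.span_induction with
    | mem u hu =>
      rcases hu with ⟨h, rfl⟩ | ⟨n, hn, x, ⟨hx, hx'⟩, rfl⟩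
      · rw [map_sub, LinearMap.sub_apply, hone 0 le_rfl _ h.2, extendWeight_zero, AlgHom.commutes,
          Module.algebraMap_end_apply, Algebra.algebraMap_eq_smul_one, sub_self]
      · rcases lt_or_gt_of_ne hn with hn | hn
        · rw [eq_zero_of_mem_nonneg hn hx hx']
          simp
        · rw [hone n hn.le x hx', extendWeight_of_ne μ hn.ne' hx', map_zero]
    | zero => simp
    | add u w _ _ hu hw => rw [map_add, LinearMap.add_apply, hu, hw, add_zero]
    | smul c u _ hu => rw [smul_eq_mul, map_mul, Module.End.mul_apply, hu, map_zero]
  have hword : ∀ (n : ℤ) (y : V) (l : List (ℤ × V)), n < 0 → y ∈ G.deg n → ∀ u p,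
      (θ (ψ (((n, y) :: l).map fun x => g.toEnv x.2).prod u) p).1 = 0 := by
    intro n y l hn hy u p
    rw [List.map_cons, List.prod_cons, map_mul, Module.End.mul_apply, hneg n hn y hy, map_mul,
      Module.End.mul_apply, hθ]
  let f : g.Env →ₗ[ℂ] ℂ := LinearMap.fst ℂ ℂ V ∘ₗ LinearMap.applyₗ (1, 0) ∘ₗ θ.toLinearMap ∘ₗ
    LinearMap.applyₗ 1 ∘ₗ ψ.toLinearMap
  have hf : ∀ u, f u = (θ (ψ u 1) (1, 0)).1 := fun _ => rfl
  refine ⟨⟨⟨f, ?_, ?_, ?_, ?_⟩⟩, ?_⟩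
  · simp [hf]
  · intro n hn u hu
    have h := envDeg_apply_mem_negWords (ψ := ψ) (E := Submodule.span ℂ {1}) hG ?_ ?_ hu
      (Submodule.mem_span_singleton_self 1)
    · have hle : G.negWords ψ (Submodule.span ℂ {1}) n ≤
          LinearMap.ker (LinearMap.fst ℂ ℂ V ∘ₗ LinearMap.applyₗ (1, 0) ∘ₗ θ.toLinearMap) := by
        rw [negWords, Submodule.span_le]
        rintro _ ⟨_ | ⟨⟨m, y⟩, l⟩, hl, hs, e, -, rfl⟩
        · exact absurd hs.symm (by simpa using hn)
        · obtain ⟨⟨hm, hy⟩, hl⟩ := List.forall_mem_cons.1 hl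
          exact hword m y l hm hy e (1, 0)
      exact hle h
    · intro n hn x hx e he
      obtain ⟨c, rfl⟩ := Submodule.mem_span_singleton.1 he
      rw [map_smul, hone n hn.le x hx, extendWeight_of_ne μ hn.ne' hx, map_zero, smul_zero]
    · intro x hx e he
      obtain ⟨c, rfl⟩ := Submodule.mem_span_singleton.1 he
      rw [map_smul, hone 0 le_rfl x hx, Algebra.algebraMap_eq_smul_one]
      exact Submodule.smul_mem _ _ (Submodule.smul_mem _ _ (Submodule.mem_span_singleton_self 1))
  · intro u hu
    rw [hf, hideal u hu]
    simp
  · intro a ha hμ w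
    -- The vectors of degree -1/2 killed by g₊. This space contains a · 1 and is stable under g₀,
    -- which the line of a need not be; hence U(g)a · 1 consists of words in g₋ applied to E and has
    -- zero augmentation.
    let E : Submodule ℂ G.NegEnv := (G.deg (-1)).map G.toNeg ⊓
      ⨅ n : ℤ, ⨅ _ : 0 < n, ⨅ x : G.deg n, LinearMap.ker (ψ (g.toEnv (x : V)))
    have hE : ∀ e, e ∈ E ↔ (∃ b ∈ G.deg (-1), G.toNeg b = e) ∧
        ∀ n, 0 < n → ∀ x ∈ G.deg n, ψ (g.toEnv x) e = 0 := by
      intro e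
      simp [E]
    have hj : ∀ b ∈ G.deg (-1), G.toNeg b = ψ (g.toEnv b) 1 := by
      intro b hb
      rw [hneg (-1) (by norm_num) b hb, mul_one]
    have hbr : ∀ m n, ∀ x ∈ G.deg m, ∀ y ∈ G.deg n, ∀ u, ψ (g.toEnv x) (ψ (g.toEnv y) u) =
        ψ (g.toEnv (g.bracket x y)) u + sgn m n • ψ (g.toEnv y) (ψ (g.toEnv x) u) := by
      intro m n x hx y hy u
      rw [toEnv_bracket hG hx hy]
      simp
    have haE : G.toNeg a ∈ E := by
      rw [hE]
      refine ⟨⟨a, ha, rfl⟩, fun n hn x hx => ?_⟩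
      have hxa := G.bracket_mem_deg _ _ _ _ hx ha
      rw [hj a ha, hbr n _ x hx a ha, hone n hn.le x hx, extendWeight_of_ne μ hn.ne' hx,
        hone _ (by omega) _ hxa]
      -- Only x of degree 1/2 brackets a into g₀, and there the hypothesis on μ applies.
      rcases eq_or_ne n 1 with rfl | hn1
      · have h0 : g.bracket x a ∈ G.deg 0 := hxa
        have := hμ ⟨_, h0⟩ ⟨x, hx, rfl⟩
        have h2 := extendWeight_zero μ ⟨_, h0⟩
        rw [this] at h2
        simp [h2]
      · rw [extendWeight_of_ne μ (by omega) hxa]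
        simp
    have hpos : ∀ n, 0 < n → ∀ x ∈ G.deg n, ∀ e ∈ E, ψ (g.toEnv x) e = 0 :=
      fun n hn x hx e he => ((hE e).1 he).2 n hn x hx
    have hzero : ∀ x ∈ G.deg 0, ∀ e ∈ E, ψ (g.toEnv x) e ∈ E := by
      intro x hx e he
      obtain ⟨⟨b, hb, rfl⟩, hk⟩ := (hE e).1 he
      rw [hE]
      constructor
      · have hxb := G.bracket_mem_deg _ _ _ _ hx hb
        rw [zero_add] at hxb
        refine ⟨_, add_mem hxb (Submodule.smul_mem _ (G.extendWeight μ x) hb), ?_⟩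
        rw [hj b hb, hbr 0 (-1) x hx b hb, hone 0 le_rfl x hx, map_add, map_smul, hj _ hxb,
          hj _ hb, Algebra.algebraMap_eq_smul_one, map_smul, sgn_zero_left, one_smul]
      · intro n hn y hy
        have hyx := G.bracket_mem_deg _ _ _ _ hy hx
        rw [add_zero] at hyx
        rw [hbr n 0 y hy x hx, hk n hn _ hyx, hk n hn y hy]
        simp
    have hw : w ∈ ⨆ n, G.envDeg n := by rw [G.iSup_envDeg]; trivial
    have hle : (⨆ n, G.envDeg n) ≤ LinearMap.ker (f ∘ₗ LinearMap.mulRight ℂ (g.toEnv a)) := by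
      refine iSup_le fun n u hu => ?_
      have h := envDeg_apply_mem_negWords hG hpos hzero hu haE
      have hle : G.negWords ψ E n ≤
          LinearMap.ker (LinearMap.fst ℂ ℂ V ∘ₗ LinearMap.applyₗ (1, 0) ∘ₗ θ.toLinearMap) := by
        rw [negWords, Submodule.span_le]
        rintro _ ⟨_ | ⟨⟨m, y⟩, l⟩, hl, hs, e, he, rfl⟩
        · obtain ⟨⟨b, hb, rfl⟩, -⟩ := (hE e).1 he
          simpa using hθ b (1, 0)
        · obtain ⟨⟨hm, hy⟩, hl⟩ := List.forall_mem_cons.1 hl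
          exact hword m y l hm hy e (1, 0)
      have := hle h
      rw [hj a ha] at this
      simpa [hf] using this
    exact hle hw
  · intro a ha hmem
    have h := hideal _ hmem
    rw [hneg (-1) (by norm_num) a ha, mul_one] at h
    have h2 := hθ1 a ha
    rw [h] at h2
    simpa using (congrArg Prod.snd h2).symm

end HalfIntGrading

end LieSuperalgebra

/-! ### The irreducible quotient as U(g) modulo `radical`. -/

namespace LieSuperalgebra

namespace HalfIntGrading

variable {V : Type u} [AddCommGroup V] [Module ℂ V] {g : LieSuperalgebra V}
variable {G : g.HalfIntGrading} {μ : Module.Dual ℂ (G.deg 0)}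

lemma lsmul_vermaVector (w : g.Env) : Algebra.lsmul ℂ ℂ (G.Verma μ) w (G.vermaVector μ) =
    (G.weightIdeal G.nonneg μ).mkQ w := by
  change w • (G.weightIdeal G.nonneg μ).mkQ 1 = _
  rw [← map_smul, smul_eq_mul, mul_one]

lemma mem_negWords_mkQ (hG : G.IsConsistent) {n : ℤ} {u : g.Env} (hu : u ∈ G.envDeg n) :
    (G.weightIdeal G.nonneg μ).mkQ u ∈
      G.negWords (Algebra.lsmul ℂ ℂ (G.Verma μ)) (Submodule.span ℂ {G.vermaVector μ}) n := by
  have hmk := lsmul_vermaVector (G := G) (μ := μ)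
  have h := envDeg_apply_mem_negWords (ψ := Algebra.lsmul ℂ ℂ (G.Verma μ))
    (E := Submodule.span ℂ {G.vermaVector μ}) hG ?_ ?_ hu (Submodule.mem_span_singleton_self _)
  · rwa [hmk] at h
  · intro n hn x hx e he
    obtain ⟨c, rfl⟩ := Submodule.mem_span_singleton.1 he
    rw [map_smul, hmk, Submodule.mkQ_apply, (Submodule.Quotient.mk_eq_zero _).2
      (toEnv_mem_weightIdeal hn.ne' (deg_le_nonneg hn.le hx) hx)]
    exact smul_zero (A := G.Verma μ) c
  · intro x hx e he
    obtain ⟨c, rfl⟩ := Submodule.mem_span_singleton.1 he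
    rw [map_smul, hmk]
    refine Submodule.smul_mem _ _ (Submodule.mem_span_singleton.2 ⟨μ ⟨x, hx⟩, ?_⟩)
    have h := (Submodule.Quotient.mk_eq_zero _).2 (toEnv_sub_mem_weightIdeal G.nonneg μ ⟨x, hx⟩)
    rw [Submodule.Quotient.mk_sub, sub_eq_zero, Algebra.algebraMap_eq_smul_one] at h
    exact h.symm

lemma envDeg_pos_le (hG : G.IsConsistent) {n : ℤ} (hn : 0 < n) {u : g.Env} (hu : u ∈ G.envDeg n) :
    u ∈ G.weightIdeal G.nonneg μ := by
  have h := mem_negWords_mkQ (μ := μ) hG hu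
  rwa [negWords_of_pos hn, Submodule.mem_bot, Submodule.mkQ_apply,
    Submodule.Quotient.mk_eq_zero] at h

lemma exists_sub_mem_weightIdeal (hG : G.IsConsistent) {u : g.Env} (hu : u ∈ G.envDeg 0) :
    ∃ c : ℂ, u - algebraMap ℂ g.Env c ∈ G.weightIdeal G.nonneg μ := by
  obtain ⟨c, hc⟩ := Submodule.mem_span_singleton.1
    (negWords_zero_le (mem_negWords_mkQ (μ := μ) hG hu))
  refine ⟨c, ?_⟩
  rw [← Submodule.Quotient.mk_eq_zero, Submodule.Quotient.mk_sub, sub_eq_zero,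
    Algebra.algebraMap_eq_smul_one]
  exact hc.symm

/-- Modulo the ideal of M(μ), U(g) in negative degree n is spanned by non-empty words in g₋, whose
first letter has degree between n and 0. This prepares the finiteness induction. -/
lemma envDeg_neg_le (hG : G.IsConsistent) {n : ℤ} (hn : n < 0) (T : Submodule ℂ g.Env)
    (hI : (G.weightIdeal G.nonneg μ).restrictScalars ℂ ≤ T)
    (hT : ∀ d, n ≤ d → d < 0 → ∀ y ∈ G.deg d, ∀ w ∈ G.envDeg (n - d), g.toEnv y * w ∈ T) :
    G.envDeg n ≤ T := by
  intro u hu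
  have hle : G.negWords (Algebra.lsmul ℂ ℂ (G.Verma μ)) (Submodule.span ℂ {G.vermaVector μ}) n ≤
      T.map ((G.weightIdeal G.nonneg μ).mkQ.restrictScalars ℂ) := by
    rw [negWords, Submodule.span_le]
    rintro _ ⟨_ | ⟨⟨d, y⟩, l⟩, hl, hs, e, he, rfl⟩
    · exact absurd hs.symm (by simpa using hn.ne)
    · obtain ⟨⟨hd, hy⟩, hl⟩ := List.forall_mem_cons.1 hl
      obtain ⟨c, rfl⟩ := Submodule.mem_span_singleton.1 he
      have h0 := sum_fst_nonpos hl
      rw [List.map_cons, List.sum_cons] at hs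
      rw [map_smul]
      refine Submodule.smul_mem _ _ ⟨g.toEnv y * (l.map fun x => g.toEnv x.2).prod, ?_, ?_⟩
      · refine hT d (by simp only at hs; omega) hd y hy _
          (Submodule.subset_span ⟨l, fun x hx => (hl x hx).2, ?_, rfl⟩)
        simp only at hs
        omega
      · rw [List.map_cons, List.prod_cons, lsmul_vermaVector]
        rfl
  obtain ⟨w, hw, h⟩ := hle (mem_negWords_mkQ hG hu)
  have h' : u - w ∈ G.weightIdeal G.nonneg μ := by
    rw [← Submodule.Quotient.mk_eq_zero, Submodule.Quotient.mk_sub, sub_eq_zero]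
    exact h.symm
  have := T.add_mem (hI h') hw
  rwa [sub_add_cancel] at this

namespace WeightFunctional

variable (F : G.WeightFunctional μ)

/-- The largest left ideal in the kernel of the projection to the highest weight line; the
annihilator of the highest weight vector of `L(μ)`. -/
def radical : Submodule g.Env g.Env where
  carrier := {u | ∀ w, F.toFun (w * u) = 0}
  add_mem' hu hw z := by rw [mul_add, map_add, hu, hw, add_zero]
  zero_mem' z := by rw [mul_zero, map_zero]
  smul_mem' c u hu z := by rw [smul_eq_mul, ← mul_assoc, hu]

lemma apply_of_mem_radical {u : g.Env} (hu : u ∈ F.radical) : F.toFun u = 0 := by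
  simpa using hu 1

lemma le_radical {J : Submodule g.Env g.Env} (hJ : ∀ u ∈ J, F.toFun u = 0) : J ≤ F.radical :=
  fun _ hu w => hJ _ (J.smul_mem w hu)

lemma mul_mem_radical (w : g.Env) {u : g.Env} (hu : u ∈ F.radical) : w * u ∈ F.radical :=
  F.radical.smul_mem w hu

lemma smul_mem_radical (c : ℂ) {u : g.Env} (hu : u ∈ F.radical) : c • u ∈ F.radical :=
  (F.radical.restrictScalars ℂ).smul_mem c hu

lemma weightIdeal_le_radical : G.weightIdeal G.nonneg μ ≤ F.radical :=
  F.le_radical F.map_ideal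

lemma apply_algebraMap (c : ℂ) : F.toFun (algebraMap ℂ g.Env c) = c := by
  rw [Algebra.algebraMap_eq_smul_one, map_smul, F.map_one, smul_eq_mul, mul_one]

lemma one_notMem_radical : (1 : g.Env) ∉ F.radical := fun h => by
  have := F.apply_of_mem_radical h
  rw [F.map_one] at this
  exact one_ne_zero this

/-- An element of non-zero degree that acts on the highest weight vector of `L(μ)` by a scalar
annihilates it. -/
lemma mem_radical_of_sub_mem {n : ℤ} (hn : n ≠ 0) {u : g.Env} (hu : u ∈ G.envDeg n) {c : ℂ}
    (h : u - algebraMap ℂ g.Env c ∈ F.radical) : u ∈ F.radical := by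
  have h2 := F.apply_of_mem_radical h
  rw [map_sub, F.map_deg n hn u hu, apply_algebraMap, zero_sub, neg_eq_zero] at h2
  rwa [h2, map_zero, sub_zero] at h

/-- Testing u against w of degree -n sees only the component of u of degree n, since `F` vanishes
off degree 0. -/
lemma isGraded_radical : F.radical.restrictScalars ℂ =
    ⨆ n, F.radical.restrictScalars ℂ ⊓ G.envDeg n := by
  refine le_antisymm (fun u hu => ?_) (iSup_le fun n => inf_le_left)
  have hu' : u ∈ ⨆ n, G.envDeg n := by rw [G.iSup_envDeg]; trivial
  obtain ⟨c, hc, rfl⟩ := (Submodule.mem_iSup_iff_exists_finsupp _ _).1 hu'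
  refine Submodule.sum_mem _ fun n _ => Submodule.mem_iSup_of_mem n ⟨?_, hc n⟩
  intro w
  have hw : w ∈ ⨆ n, G.envDeg n := by rw [G.iSup_envDeg]; trivial
  have hle : (⨆ n, G.envDeg n) ≤ LinearMap.ker (F.toFun ∘ₗ LinearMap.mulRight ℂ (c n)) := by
    refine iSup_le fun m w hw => ?_
    simp only [LinearMap.mem_ker, LinearMap.comp_apply, LinearMap.mulRight_apply]
    rcases eq_or_ne (m + n) 0 with hmn | hmn
    · have h := hu w
      rw [Finsupp.sum, Finset.mul_sum, map_sum] at h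
      rwa [Finset.sum_eq_single n] at h
      · intro k _ hk
        exact F.map_deg (m + k) (by omega) _ (G.mul_mem_envDeg hw (hc k))
      · intro hn
        rw [Finsupp.notMem_support_iff.1 hn, mul_zero, map_zero]
    · exact F.map_deg _ hmn _ (G.mul_mem_envDeg hw (hc n))
  exact hle hw

end WeightFunctional

/-- The quotient map from `U(g)` to the irreducible quotient of an induced module. -/
def irrMk (p : Submodule ℂ V) (μ : Module.Dual ℂ (G.deg 0)) :
    g.Env →ₗ[g.Env] G.IrrInduced p μ :=
  (maxGradedSubmodule g.Env (G.inducedDeg p μ)).mkQ ∘ₗ (G.weightIdeal p μ).mkQ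

lemma irrMk_surjective (p : Submodule ℂ V) (μ : Module.Dual ℂ (G.deg 0)) :
    Function.Surjective (irrMk p μ) :=
  (Submodule.mkQ_surjective _).comp (Submodule.mkQ_surjective _)

lemma irrInducedDeg_eq (p : Submodule ℂ V) (μ : Module.Dual ℂ (G.deg 0)) (n : ℤ) :
    G.irrInducedDeg p μ n = (G.envDeg n).map ((irrMk p μ).restrictScalars ℂ) := by
  rw [irrInducedDeg, quotientDeg, inducedDeg, quotientDeg, ← Submodule.map_comp]
  rfl

/-- The degree 0 component is spanned by the generator, which no proper submodule contains. So a
proper graded submodule pulls back into ker `F`, hence into `radical`. Conversely the image of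
`radical` is graded, and proper because 1 ∉ `radical`. The answer does not depend on p. -/
lemma ker_irrMk (hG : G.IsConsistent) (F : G.WeightFunctional μ) {p : Submodule ℂ V}
    (hp : G.weightIdeal G.nonneg μ ≤ G.weightIdeal p μ)
    (hR : G.weightIdeal p μ ≤ F.radical) : LinearMap.ker (irrMk p μ) = F.radical := by
  set I := G.weightIdeal p μ with hI
  have key : maxGradedSubmodule g.Env (G.inducedDeg p μ) = F.radical.map I.mkQ := by
    refine le_antisymm (sSup_le ?_) (le_sSup ⟨?_, ?_⟩)
    · rintro N ⟨hN, hN1⟩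
      have hNf : N.restrictScalars ℂ ≤
          (LinearMap.ker F.toFun).map (I.mkQ.restrictScalars ℂ) := by
        rw [hN]
        refine iSup_le fun n => ?_
        rintro _ ⟨hN2, u, hu, rfl⟩
        rcases eq_or_ne n 0 with rfl | hn
        · obtain ⟨c, hc⟩ := exists_sub_mem_weightIdeal (μ := μ) hG hu
          rcases eq_or_ne c 0 with rfl | hc0
          · rw [map_zero, sub_zero] at hc
            exact ⟨u, F.map_ideal u hc, rfl⟩
          · exfalso
            apply hN1
            have h1 : I.mkQ 1 ∈ N := by
              have h2 : I.mkQ (algebraMap ℂ g.Env c⁻¹ * (u - algebraMap ℂ g.Env c)) = 0 :=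
                (Submodule.Quotient.mk_eq_zero _).2 (I.smul_mem _ (hp hc))
              rw [mul_sub, ← map_mul, inv_mul_cancel₀ hc0, map_one, map_sub, sub_eq_zero] at h2
              rw [← h2, ← smul_eq_mul, map_smul]
              exact N.smul_mem _ hN2
            rw [eq_top_iff]
            intro x _
            obtain ⟨w, rfl⟩ := I.mkQ_surjective x
            have := N.smul_mem w h1
            rwa [← map_smul, smul_eq_mul, mul_one] at this
        · exact ⟨u, F.map_deg n hn u hu, rfl⟩
      have hcomap : N.comap I.mkQ ≤ F.radical := by
        refine F.le_radical fun u hu => ?_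
        obtain ⟨w, hw, h⟩ := hNf (x := I.mkQ u) hu
        have h' : u - w ∈ I := by
          rw [← Submodule.Quotient.mk_eq_zero, Submodule.Quotient.mk_sub, sub_eq_zero]
          exact h.symm
        have h2 := F.apply_of_mem_radical (hR h')
        rwa [map_sub, LinearMap.mem_ker.1 hw, sub_zero] at h2
      rw [← Submodule.map_comap_eq_of_surjective I.mkQ_surjective N]
      exact Submodule.map_mono hcomap
    · refine le_antisymm ?_ (iSup_le fun n => inf_le_left)
      rintro _ ⟨u, hu, rfl⟩
      have hu' : u ∈ F.radical.restrictScalars ℂ := hu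
      rw [F.isGraded_radical] at hu'
      have : (⨆ n, F.radical.restrictScalars ℂ ⊓ G.envDeg n) ≤
          (⨆ n, (F.radical.map I.mkQ).restrictScalars ℂ ⊓ G.inducedDeg p μ n).comap
            (I.mkQ.restrictScalars ℂ) := by
        refine iSup_le fun n w hw => Submodule.mem_iSup_of_mem n ⟨?_, ?_⟩
        · exact Submodule.mem_map_of_mem hw.1
        · exact Submodule.mem_map_of_mem (f := I.mkQ.restrictScalars ℂ) hw.2
      exact this hu'
    · intro h
      have h1 : I.mkQ 1 ∈ F.radical.map I.mkQ := by rw [h]; trivial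
      rw [← Submodule.mem_comap, Submodule.comap_map_mkQ, sup_eq_right.2 hR] at h1
      exact F.one_notMem_radical h1
  rw [irrMk, LinearMap.ker_comp, Submodule.ker_mkQ, key, Submodule.comap_map_mkQ,
    sup_eq_right.2 hR]

end HalfIntGrading

end LieSuperalgebra

/-! ### The stabilizer of the highest weight line and quasifiniteness. -/

namespace LieSuperalgebra

namespace HalfIntGrading

variable {V : Type u} [AddCommGroup V] [Module ℂ V] {g : LieSuperalgebra V}
variable {G : g.HalfIntGrading} {μ : Module.Dual ℂ (G.deg 0)}

lemma exists_fg_sup_comap {W : Type*} [AddCommGroup W] [Module ℂ W] (D K : Submodule ℂ W)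
    [FiniteDimensional ℂ (D ⧸ K.comap D.subtype)] :
    ∃ C ≤ D, C.FG ∧ ∀ x ∈ D, ∃ c ∈ C, x - c ∈ K := by
  obtain ⟨C, hC⟩ := Submodule.exists_isCompl (K.comap D.subtype)
  have : FiniteDimensional ℂ C := (Submodule.quotientEquivOfIsCompl _ C hC).finiteDimensional
  refine ⟨C.map D.subtype, Submodule.map_subtype_le _ _,
    ((Submodule.fg_iff_finiteDimensional C).2 this).map _, fun x hx => ?_⟩
  have h : (⟨x, hx⟩ : D) ∈ K.comap D.subtype ⊔ C := by rw [hC.sup_eq_top]; trivial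
  obtain ⟨k, hk, c, hc, h⟩ := Submodule.mem_sup.1 h
  refine ⟨c, Submodule.mem_map_of_mem hc, ?_⟩
  have h' : x = k + c := (congrArg D.subtype h).symm
  rw [h', add_sub_cancel_right]
  exact hk

lemma finite_quotient_comap_mono {W : Type*} [AddCommGroup W] [Module ℂ W] {D K K' : Submodule ℂ W}
    (h : ∀ x ∈ D, x ∈ K → x ∈ K') [FiniteDimensional ℂ (D ⧸ K.comap D.subtype)] :
    FiniteDimensional ℂ (D ⧸ K'.comap D.subtype) :=
  have hle : K.comap D.subtype ≤ K'.comap D.subtype := fun x hx => h x x.2 hx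
  Module.Finite.of_surjective (Submodule.factor hle) (Submodule.factor_surjective hle)

lemma weightIdeal_mono {p p' : Submodule ℂ V} (h : p ≤ p') :
    G.weightIdeal p μ ≤ G.weightIdeal p' μ := by
  refine Submodule.span_mono (Set.union_subset_union_right _ ?_)
  rintro _ ⟨n, hn, x, hx, rfl⟩
  exact ⟨n, hn, x, ⟨h hx.1, hx.2⟩, rfl⟩

namespace WeightFunctional

variable (F : G.WeightFunctional μ)

lemma toEnv_pos_mem_radical {n : ℤ} (hn : 0 < n) {x : V} (hx : x ∈ G.deg n) :
    g.toEnv x ∈ F.radical :=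
  F.weightIdeal_le_radical (toEnv_mem_weightIdeal hn.ne' (deg_le_nonneg hn.le hx) hx)

lemma toEnv_sub_mem_radical (h : G.deg 0) :
    g.toEnv (h : V) - algebraMap ℂ g.Env (μ h) ∈ F.radical :=
  F.weightIdeal_le_radical (toEnv_sub_mem_weightIdeal _ μ h)

lemma weight_eq_zero {h : G.deg 0} (hh : g.toEnv (h : V) ∈ F.radical) : μ h = 0 := by
  have := F.apply_of_mem_radical (sub_mem hh (F.toEnv_sub_mem_radical h))
  rwa [sub_sub_cancel, apply_algebraMap] at this

lemma mul_toEnv_zero_mem_radical {u : g.Env} (hu : u ∈ F.radical) {x : V} (hx : x ∈ G.deg 0) :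
    u * g.toEnv x ∈ F.radical := by
  have h := F.mul_mem_radical u (F.toEnv_sub_mem_radical ⟨x, hx⟩)
  rw [mul_sub, ← Algebra.commutes, ← Algebra.smul_def] at h
  simpa using add_mem h (F.smul_mem_radical (μ ⟨x, hx⟩) hu)

/-- Each of x, y acts on the highest weight vector by a scalar, zero outside degree 0, so their
supercommutator kills it; for two elements of g₀ the bracket itself is 0. When [x, y] lands in g₀
this forces μ([x, y]) = 0. -/
lemma toEnv_bracket_mem_radical (hG : G.IsConsistent) (h1 : G.SP1) {m n : ℤ} {x y : V}
    (hx : x ∈ G.deg m) (hy : y ∈ G.deg n) (hx' : m ≠ 0 → g.toEnv x ∈ F.radical)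
    (hy' : n ≠ 0 → g.toEnv y ∈ F.radical) : g.toEnv (g.bracket x y) ∈ F.radical := by
  rcases eq_or_ne m 0 with rfl | hm
  · rcases eq_or_ne n 0 with rfl | hn
    · rw [h1 x hx y hy, map_zero]
      exact zero_mem _
    · rw [toEnv_bracket hG hx hy]
      exact sub_mem (F.mul_mem_radical _ (hy' hn))
        (F.smul_mem_radical _ (F.mul_toEnv_zero_mem_radical (hy' hn) hx))
  · rw [toEnv_bracket hG hx hy]
    refine sub_mem ?_ (F.smul_mem_radical _ (F.mul_mem_radical _ (hx' hm)))
    rcases eq_or_ne n 0 with rfl | hn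
    · exact F.mul_toEnv_zero_mem_radical (hx' hm) hy
    · exact F.mul_mem_radical _ (hy' hn)

/-- The homogeneous elements of `g` that act on the highest weight vector of `L(μ)` by a scalar. -/
def stabilizerSet : Set V := {x | ∃ n, x ∈ G.deg n ∧ (n ≠ 0 → g.toEnv x ∈ F.radical)}

/-- The stabilizer in `g` of the highest weight line of `L(μ)`. -/
def stabilizer : Submodule ℂ V := Submodule.span ℂ F.stabilizerSet

lemma nonneg_le_stabilizer : G.nonneg ≤ F.stabilizer :=
  iSup_le fun n => iSup_le fun hn _ hx => Submodule.subset_span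
    ⟨n, hx, fun h => F.toEnv_pos_mem_radical (lt_of_le_of_ne hn h.symm) hx⟩

/-- Every element of the span acts on the highest weight vector by a scalar, and in non-zero degree
that scalar must be 0. -/
lemma toEnv_mem_radical_of_mem_stabilizer {x : V} (hx : x ∈ F.stabilizer) {n : ℤ} (hn : n ≠ 0)
    (hxn : x ∈ G.deg n) : g.toEnv x ∈ F.radical := by
  have hle : F.stabilizer ≤ (F.radical.restrictScalars ℂ ⊔
      LinearMap.range (Algebra.linearMap ℂ g.Env)).comap g.toEnv := by
    rw [stabilizer, Submodule.span_le]
    rintro x ⟨n, hx, h⟩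
    rcases eq_or_ne n 0 with rfl | hn
    · exact Submodule.mem_sup.2 ⟨_, F.toEnv_sub_mem_radical ⟨x, hx⟩, _, ⟨μ ⟨x, hx⟩, rfl⟩,
        sub_add_cancel _ _⟩
    · exact Submodule.mem_sup_left (h hn)
  obtain ⟨r, hr, _, ⟨c, rfl⟩, h⟩ := Submodule.mem_sup.1 (hle hx)
  refine F.mem_radical_of_sub_mem hn (G.toEnv_mem_envDeg hxn) (c := c) ?_
  rw [← h, Algebra.linearMap_apply, add_sub_cancel_right]
  exact hr

lemma map₂_bracket_stabilizer (hG : G.IsConsistent) (h1 : G.SP1) :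
    Submodule.map₂ g.bracket F.stabilizer F.stabilizer ≤
      F.stabilizer ⊓ (F.radical.restrictScalars ℂ).comap g.toEnv := by
  rw [stabilizer, Submodule.map₂_span_span, Submodule.span_le]
  rintro _ ⟨x, ⟨m, hx, hx'⟩, y, ⟨n, hy, hy'⟩, rfl⟩
  have h := F.toEnv_bracket_mem_radical hG h1 hx hy hx' hy'
  exact ⟨Submodule.subset_span ⟨m + n, G.bracket_mem_deg _ _ _ _ hx hy, fun _ => h⟩, h⟩

lemma iterBracket_le (hG : G.IsConsistent) (h1 : G.SP1) {a : V} (ha : a ∈ G.deg (-1))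
    (haR : g.toEnv a ∈ F.radical) (m : ℕ) :
    G.iterBracket a m ≤ G.deg (-1) ⊓ (F.radical.restrictScalars ℂ).comap g.toEnv := by
  induction m with
  | zero =>
    rw [iterBracket, Submodule.span_singleton_le_iff_mem]
    exact ⟨ha, haR⟩
  | succ m ih =>
    rw [iterBracket, Submodule.map₂_le]
    intro x hx y hy
    obtain ⟨hx1, hx2⟩ := ih hx
    refine ⟨by simpa using G.bracket_mem_deg _ _ _ _ hx1 hy, ?_⟩
    exact F.toEnv_bracket_mem_radical hG h1 hx1 hy (fun _ => hx2) fun h => absurd rfl h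

lemma paraNeg_le (hG : G.IsConsistent) (h1 : G.SP1) {a : V} (ha : a ∈ G.deg (-1))
    (haR : g.toEnv a ∈ F.radical) (k : ℕ) :
    G.paraNeg a k ≤ G.deg (-(k + 1)) ⊓ (F.radical.restrictScalars ℂ).comap g.toEnv := by
  have h0 := iSup_le (F.iterBracket_le hG h1 ha haR)
  induction k with
  | zero => simpa [paraNeg] using h0
  | succ k ih =>
    rw [paraNeg, Submodule.map₂_le]
    intro x hx y hy
    obtain ⟨hx1, hx2⟩ := h0 hx
    obtain ⟨hy1, hy2⟩ := ih hy
    refine ⟨?_, F.toEnv_bracket_mem_radical hG h1 hx1 hy1 (fun _ => hx2) fun _ => hy2⟩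
    have := G.bracket_mem_deg _ _ _ _ hx1 hy1
    rwa [show (-1 : ℤ) + -(k + 1) = -((k + 1 : ℕ) + 1) by push_cast; ring] at this

lemma para_le_stabilizer (hG : G.IsConsistent) (h1 : G.SP1) {a : V} (ha : a ∈ G.deg (-1))
    (haR : g.toEnv a ∈ F.radical) : G.para a ≤ F.stabilizer :=
  sup_le F.nonneg_le_stabilizer <| iSup_le fun k _ hx =>
    Submodule.subset_span ⟨_, (F.paraNeg_le hG h1 ha haR k hx).1,
      fun _ => (F.paraNeg_le hG h1 ha haR k hx).2⟩

lemma weightIdeal_le_radical_of_le {p : Submodule ℂ V} (hp : p ≤ F.stabilizer) :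
    G.weightIdeal p μ ≤ F.radical := by
  rw [weightIdeal, Submodule.span_le]
  rintro _ (⟨h, rfl⟩ | ⟨n, hn, x, ⟨hx, hx'⟩, rfl⟩)
  · exact F.toEnv_sub_mem_radical h
  · exact F.toEnv_mem_radical_of_mem_stabilizer (hp hx) hn hx'

/-- The components of `U(g)` are finite-dimensional modulo the annihilator of the highest weight
vector of `L(μ)` as soon as those of `g₋` are. -/
lemma exists_fg_envDeg_le (hG : G.IsConsistent)
    (hfin : ∀ d < 0, FiniteDimensional ℂ (G.deg d ⧸
      ((F.radical.restrictScalars ℂ).comap g.toEnv).comap (G.deg d).subtype)) (n : ℤ) :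
    ∃ T : Submodule ℂ g.Env, T.FG ∧ G.envDeg n ≤ F.radical.restrictScalars ℂ ⊔ T := by
  have hex : ∀ d : ℤ, ∃ C ≤ G.deg d, C.FG ∧ (d < 0 → ∀ x ∈ G.deg d, ∃ c ∈ C,
      x - c ∈ (F.radical.restrictScalars ℂ).comap g.toEnv) := by
    intro d
    by_cases hd : d < 0
    · have := hfin d hd
      obtain ⟨C, h1, h2, h3⟩ := exists_fg_sup_comap (G.deg d)
        ((F.radical.restrictScalars ℂ).comap g.toEnv)
      exact ⟨C, h1, h2, fun _ => h3⟩
    · exact ⟨⊥, bot_le, Submodule.fg_bot, fun h => absurd h hd⟩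
  choose C hCdeg hCfg hC using hex
  let R := F.radical.restrictScalars ℂ
  -- Products whose first factor lies in the finite-dimensional complement `C e`, modulo `radical`.
  -- The claim is that they exhaust U(g) in negative degree n.
  let D : ℤ → Submodule ℂ g.Env := fun n =>
    R ⊔ ⨆ e ∈ Finset.Ico n 0, (C e).map g.toEnv * G.envDeg (n - e)
  have hD : ∀ n e, n ≤ e → e < 0 → ∀ c ∈ C e, ∀ w ∈ G.envDeg (n - e), g.toEnv c * w ∈ D n :=
    fun n e hne he c hc w hw => Submodule.mem_sup_right <| Submodule.mem_iSup_of_mem e <|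
      Submodule.mem_iSup_of_mem (Finset.mem_Ico.2 ⟨hne, he⟩) <|
        Submodule.mul_mem_mul (Submodule.mem_map_of_mem hc) hw
  have hUD : ∀ N : ℕ, ∀ n : ℤ, n < 0 → -n ≤ N → G.envDeg n ≤ D n := by
    intro N
    induction N with
    | zero => intro n hn hN; simp at hN; omega
    | succ N ih =>
      intro n hn hN
      -- Split y = c + x with c in `C d` and x killing the highest weight vector. By the outer
      -- induction w may be taken as c' w' with c' in `C e`, modulo `radical`; then x c' w' = [x,
      -- c'] w' ± c' x w'. The last term lies in `D n`, and [x, c'] has degree d + e, closer to n.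
      have key : ∀ k : ℕ, ∀ d, d - n ≤ k → n ≤ d → d < 0 → ∀ y ∈ G.deg d,
          ∀ w ∈ G.envDeg (n - d), g.toEnv y * w ∈ D n := by
        intro k
        induction k using Nat.strong_induction_on with
        | _ k ihk =>
        intro d hk hnd hd y hy w hw
        obtain ⟨c, hc, hyc⟩ := hC d hd y hy
        rw [← sub_add_cancel y c, map_add, add_mul]
        refine add_mem ?_ (hD n d hnd hd c hc w hw)
        have hx : y - c ∈ G.deg d := sub_mem hy (hCdeg d hc)
        generalize y - c = x at hx hyc
        rcases eq_or_lt_of_le hnd with rfl | hnd'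
        -- Here w has degree 0 and acts on the highest weight vector by a scalar, so x w lies in
        -- `radical`.
        · rw [sub_self] at hw
          obtain ⟨r, hr⟩ := exists_sub_mem_weightIdeal (μ := μ) hG hw
          have h := F.mul_mem_radical (g.toEnv x) (F.weightIdeal_le_radical hr)
          rw [mul_sub, ← Algebra.commutes, ← Algebra.smul_def] at h
          refine Submodule.mem_sup_left ?_
          have h' := add_mem h (F.smul_mem_radical r hyc)
          rwa [sub_add_cancel] at h'
        · have hle : D (n - d) ≤ (D n).comap (LinearMap.mulLeft ℂ (g.toEnv x)) := by
            refine sup_le (fun r hr => Submodule.mem_sup_left (F.mul_mem_radical _ hr)) ?_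
            refine iSup_le fun e => iSup_le fun he => Submodule.mul_le.2 ?_
            rintro _ ⟨c, hc, rfl⟩ w hw
            obtain ⟨he1, he2⟩ := Finset.mem_Ico.1 he
            have hcd := hCdeg e hc
            have hxc : g.toEnv x * (g.toEnv c * w) = g.toEnv (g.bracket x c) * w +
                sgn d e • (g.toEnv c * (g.toEnv x * w)) := by
              rw [toEnv_bracket hG hx hcd, sub_mul, smul_mul_assoc, mul_assoc, mul_assoc]
              abel
            simp only [Submodule.mem_comap, LinearMap.mulLeft_apply]
            rw [hxc]
            refine add_mem ?_ (Submodule.smul_mem _ _ ?_)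
            · refine ihk (d + e - n).toNat (by omega) (d + e) (by omega) (by omega) (by omega) _
                (G.bracket_mem_deg _ _ _ _ hx hcd) w ?_
              rwa [← sub_sub]
            · refine hD n e (by omega) he2 c hc _ ?_
              have := G.mul_mem_envDeg (G.toEnv_mem_envDeg hx) hw
              rwa [show d + (n - d - e) = n - e by ring] at this
          exact hle (ih (n - d) (by omega) (by push_cast at hN; omega) hw)
      refine envDeg_neg_le (μ := μ) hG hn _ (le_sup_of_le_left F.weightIdeal_le_radical) ?_
      intro d hnd hd y hy w hw
      exact key (d - n).toNat d (by omega) hnd hd y hy w hw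
  -- In `D n` the second factor has degree n - e > n, so by induction it may be taken in a
  -- finite-dimensional space.
  have hfg : ∀ N : ℕ, ∀ n : ℤ, -n ≤ N → ∃ T : Submodule ℂ g.Env, T.FG ∧ G.envDeg n ≤ R ⊔ T := by
    intro N
    induction N with
    | zero =>
      intro n hn
      rcases eq_or_lt_of_le (show 0 ≤ n by simpa using hn) with rfl | hn
      · refine ⟨Submodule.span ℂ {1}, Submodule.fg_span_singleton _, fun u hu => ?_⟩
        obtain ⟨c, hc⟩ := exists_sub_mem_weightIdeal (μ := μ) hG hu
        refine Submodule.mem_sup.2 ⟨_, F.weightIdeal_le_radical hc, algebraMap ℂ g.Env c, ?_,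
          sub_add_cancel _ _⟩
        exact Submodule.mem_span_singleton.2 ⟨c, (Algebra.algebraMap_eq_smul_one c).symm⟩
      · exact ⟨⊥, Submodule.fg_bot, fun u hu =>
          Submodule.mem_sup_left (F.weightIdeal_le_radical (envDeg_pos_le hG hn hu))⟩
    | succ N ih =>
      intro n hn
      rcases le_or_gt 0 n with h0 | h0
      · exact ih n (by omega)
      · have hex : ∀ m : ℤ, ∃ T : Submodule ℂ g.Env, T.FG ∧ (-m ≤ N → G.envDeg m ≤ R ⊔ T) := by
          intro m
          by_cases hm : -m ≤ N
          · obtain ⟨T, h1, h2⟩ := ih m hm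
            exact ⟨T, h1, fun _ => h2⟩
          · exact ⟨⊥, Submodule.fg_bot, fun h => absurd h hm⟩
        choose T hTfg hT using hex
        refine ⟨⨆ e ∈ Finset.Ico n 0, (C e).map g.toEnv * T (n - e),
          Submodule.fg_biSup _ _ fun e _ => ((hCfg e).map _).mul (hTfg _), ?_⟩
        refine (hUD _ n h0 hn).trans (sup_le le_sup_left (iSup₂_le fun e he => ?_))
        obtain ⟨he1, he2⟩ := Finset.mem_Ico.1 he
        refine Submodule.mul_le.2 fun c hc w hw => ?_
        obtain ⟨r, hr, t, ht, rfl⟩ := Submodule.mem_sup.1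
          (hT (n - e) (by push_cast at hn; omega) hw)
        rw [mul_add]
        refine add_mem (Submodule.mem_sup_left (F.mul_mem_radical _ hr)) (Submodule.mem_sup_right ?_)
        exact Submodule.mem_iSup_of_mem e (Submodule.mem_iSup_of_mem he (Submodule.mul_mem_mul hc ht))
  exact hfg n.natAbs n (by omega)

lemma ker_irrMk_nonneg (hG : G.IsConsistent) : LinearMap.ker (irrMk G.nonneg μ) = F.radical :=
  ker_irrMk hG F le_rfl F.weightIdeal_le_radical

lemma isQuasifinite_irrDeg (hG : G.IsConsistent)
    (hfin : ∀ d < 0, FiniteDimensional ℂ (G.deg d ⧸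
      ((F.radical.restrictScalars ℂ).comap g.toEnv).comap (G.deg d).subtype)) :
    IsQuasifinite (G.irrDeg μ) := by
  intro n
  obtain ⟨T, hT, hle⟩ := F.exists_fg_envDeg_le hG hfin n
  have h : G.irrDeg μ n ≤ T.map ((irrMk G.nonneg μ).restrictScalars ℂ) := by
    rw [irrDeg, irrInducedDeg_eq]
    refine (Submodule.map_mono hle).trans ?_
    rw [Submodule.map_sup]
    refine sup_le ?_ le_rfl
    rintro _ ⟨u, hu, rfl⟩
    have : u ∈ LinearMap.ker (irrMk G.nonneg μ) := by rw [F.ker_irrMk_nonneg hG]; exact hu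
    have h0 : (irrMk G.nonneg μ).restrictScalars ℂ u = 0 := this
    rw [h0]
    exact zero_mem _
  have := (Submodule.fg_iff_finiteDimensional _).1
    (hT.map ((irrMk G.nonneg μ).restrictScalars ℂ))
  exact Submodule.finiteDimensional_of_le h

/-- Acting on the highest weight vector embeds this quotient of g_d into the corresponding component
of L(μ). -/
lemma finite_quotient_of_isQuasifinite (hG : G.IsConsistent) (hq : IsQuasifinite (G.irrDeg μ))
    (d : ℤ) : FiniteDimensional ℂ (G.deg d ⧸
      ((F.radical.restrictScalars ℂ).comap g.toEnv).comap (G.deg d).subtype) := by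
  have := hq d
  let f : G.deg d →ₗ[ℂ] G.irrDeg μ d :=
    (((irrMk G.nonneg μ).restrictScalars ℂ) ∘ₗ g.toEnv ∘ₗ (G.deg d).subtype).codRestrict _
      fun x => by
        rw [irrDeg, irrInducedDeg_eq]
        exact Submodule.mem_map_of_mem (G.toEnv_mem_envDeg x.2)
  have hker : LinearMap.ker f =
      ((F.radical.restrictScalars ℂ).comap g.toEnv).comap (G.deg d).subtype := by
    ext x
    have h : x ∈ LinearMap.ker f ↔ g.toEnv (x : V) ∈ LinearMap.ker (irrMk G.nonneg μ) := by
      rw [LinearMap.mem_ker, LinearMap.mem_ker, Subtype.ext_iff]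
      rfl
    rw [h, F.ker_irrMk_nonneg hG]
    rfl
  rw [← hker]
  exact Module.Finite.equiv f.quotKerEquivRange.symm

/-- If `L(μ)` is quasifinite, the stabilizer of its highest weight line is a non-degenerate
parabolic subalgebra. -/
lemma isNondegParabolic_stabilizer (hG : G.IsConsistent) (h1 : G.SP1)
    (hinf : ∃ n : ℤ, n < 0 ∧ ¬ FiniteDimensional ℂ (G.deg n))
    (hq : IsQuasifinite (G.irrDeg μ)) : G.IsNondegParabolic F.stabilizer := by
  have hmem : ∀ n, ∀ x ∈ G.deg n, g.toEnv x ∈ F.radical → x ∈ F.stabilizer :=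
    fun n x hx h => Submodule.subset_span ⟨n, hx, fun _ => h⟩
  refine ⟨⟨fun x hx y hy => (F.map₂_bracket_stabilizer hG h1
    (Submodule.apply_mem_map₂ _ hx hy)).1, ?_, F.nonneg_le_stabilizer, ?_⟩, fun n hn => ?_⟩
  · refine le_antisymm ?_ (iSup_le fun n => inf_le_left)
    conv_lhs => rw [stabilizer]
    rw [Submodule.span_le]
    rintro x ⟨n, hx, h⟩
    exact Submodule.mem_iSup_of_mem n ⟨Submodule.subset_span ⟨n, hx, h⟩, hx⟩
  -- A subspace of finite codimension in an infinite-dimensional component is non-zero.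
  · obtain ⟨n, hn, hninf⟩ := hinf
    refine ⟨n, hn, fun hbot => hninf ?_⟩
    have := F.finite_quotient_of_isQuasifinite hG hq n
    have hK : ((F.radical.restrictScalars ℂ).comap g.toEnv).comap (G.deg n).subtype = ⊥ := by
      rw [eq_bot_iff]
      intro x hx
      have : (x : V) ∈ F.stabilizer ⊓ G.deg n := ⟨hmem n x x.2 hx, x.2⟩
      rw [hbot] at this
      exact Subtype.ext this
    rw [hK] at this
    exact (Submodule.quotEquivOfEqBot ⊥ rfl).finiteDimensional
  · have := F.finite_quotient_of_isQuasifinite hG hq n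
    exact finite_quotient_comap_mono
      (K := (F.radical.restrictScalars ℂ).comap g.toEnv) (hmem n)

lemma toEnv_mem_radical {a : V} (ha : a ∈ G.deg (-1))
    (hμ : ∀ h : G.deg 0, (∃ x ∈ G.deg 1, g.bracket x a = (h : V)) → μ h = 0) :
    g.toEnv a ∈ F.radical :=
  F.map_mul_toEnv a ha hμ

lemma weight_bracket_eq_zero (hG : G.IsConsistent) (h1 : G.SP1) {a : V} (ha : a ∈ G.deg (-1))
    (haR : g.toEnv a ∈ F.radical) (h : G.deg 0)
    (hx : ∃ x ∈ G.deg 1, g.bracket x a = (h : V)) : μ h = 0 := by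
  obtain ⟨x, hx, hxa⟩ := hx
  refine F.weight_eq_zero ?_
  rw [← hxa]
  exact F.toEnv_bracket_mem_radical hG h1 hx ha
    (fun _ => F.toEnv_pos_mem_radical one_pos hx) fun _ => haR

/-- Both irreducible quotients are U(g)/`radical`, and the isomorphism is induced by the identity of
U(g), so it respects degrees. -/
lemma isIrrQuotientOfGenVerma (hG : G.IsConsistent) (h1 : G.SP1) {p : Submodule ℂ V}
    (hp : G.nonneg ≤ p) (hpF : p ≤ F.stabilizer) : G.IsIrrQuotientOfGenVerma p μ := by
  refine ⟨fun h hh => F.weight_eq_zero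
    (F.map₂_bracket_stabilizer hG h1 (Submodule.map₂_le_map₂ hpF hpF hh)).2, ?_⟩
  have hker : LinearMap.ker (irrMk G.nonneg μ) = LinearMap.ker (irrMk p μ) := by
    rw [F.ker_irrMk_nonneg hG,
      ker_irrMk hG F (weightIdeal_mono hp) (F.weightIdeal_le_radical_of_le hpF)]
  let e : G.Irr μ ≃ₗ[g.Env] G.IrrInduced p μ :=
    ((irrMk G.nonneg μ).quotKerEquivOfSurjective (irrMk_surjective _ μ)).symm ≪≫ₗ
      Submodule.quotEquivOfEq _ _ hker ≪≫ₗ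
      (irrMk p μ).quotKerEquivOfSurjective (irrMk_surjective p μ)
  have he : ∀ u, e (irrMk G.nonneg μ u) = irrMk p μ u := by
    intro u
    have : ((irrMk G.nonneg μ).quotKerEquivOfSurjective (irrMk_surjective _ μ)).symm
        (irrMk G.nonneg μ u) = Submodule.Quotient.mk u := by
      rw [LinearEquiv.symm_apply_eq]
      rfl
    simp only [e, LinearEquiv.trans_apply, this]
    rfl
  refine ⟨e, fun n => ?_⟩
  rw [irrDeg, irrInducedDeg_eq, irrInducedDeg_eq, ← Submodule.map_comp]
  congr 1
  exact LinearMap.ext he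

end WeightFunctional

end HalfIntGrading

end LieSuperalgebra

/-! ### The equivalences. -/

open LieSuperalgebra LieSuperalgebra.HalfIntGrading

/-- Characterization of the quasifinite irreducible highest weight modules. -/
theorem mainTheorem2 {V : Type*} [AddCommGroup V] [Module ℂ V]
    (g : LieSuperalgebra V) (G : g.HalfIntGrading) (hG : G.IsConsistent)
    (h1 : G.SP1) (h2 : G.SP2) (h3 : G.SP3)
    (hinf : ∃ n : ℤ, n < 0 ∧ ¬ FiniteDimensional ℂ (G.deg n))
    (μ : Module.Dual ℂ (G.deg 0)) :
    List.TFAE [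
      ∃ a : V, G.IsNondegElement a ∧
        g.toEnv a • G.vermaVector μ ∈ G.vermaDeg μ (-1) ∧
        G.IsSingular (g.toEnv a • G.vermaVector μ),
      ∃ a : V, G.IsNondegElement a ∧
        ∀ h : G.deg 0, (∃ x ∈ G.deg 1, g.bracket x a = (h : V)) → μ h = 0,
      LieSuperalgebra.IsQuasifinite (G.irrDeg μ),
      ∃ a : V, G.IsNondegElement a ∧ G.IsIrrQuotientOfGenVerma (G.para a) μ] := by
  obtain ⟨⟨F⟩, hinj⟩ := exists_weightFunctional hG h1 μ
  have hsmul : ∀ u : g.Env, u • G.vermaVector μ = (G.weightIdeal G.nonneg μ).mkQ u := by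
    intro u
    change u • (G.weightIdeal G.nonneg μ).mkQ 1 = _
    rw [← map_smul, smul_eq_mul, mul_one]
  have hzero : ∀ u : g.Env, u • G.vermaVector μ = 0 ↔ u ∈ G.weightIdeal G.nonneg μ := by
    intro u
    rw [hsmul, Submodule.mkQ_apply, Submodule.Quotient.mk_eq_zero]
  tfae_have 1 → 2 := by
    rintro ⟨a, ha, -, -, hsing⟩
    refine ⟨a, ha, fun h ⟨x, hx, hxa⟩ => F.weight_eq_zero (F.weightIdeal_le_radical ?_)⟩
    have hs := hsing 1 one_pos x hx
    rw [smul_smul, hzero] at hs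
    -- Both x a and a x kill v_λ, hence so does [x, a], which acts by μ([x, a]).
    rw [← hxa, toEnv_bracket hG hx ha.1]
    refine sub_mem hs (Submodule.smul_of_tower_mem _ _ ?_)
    exact (G.weightIdeal G.nonneg μ).smul_mem _
      (toEnv_mem_weightIdeal one_ne_zero (deg_le_nonneg zero_le_one hx) hx)
  tfae_have 2 → 1 := by
    rintro ⟨a, ha, hμ⟩
    refine ⟨a, ha, ?_, fun h => ha.2.1 (hinj a ha.1 ((hzero _).1 h)), fun n hn x hx => ?_⟩
    · rw [hsmul]
      exact Submodule.mem_map_of_mem (f := (G.weightIdeal G.nonneg μ).mkQ.restrictScalars ℂ)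
        (G.toEnv_mem_envDeg ha.1)
    · rw [smul_smul, hzero]
      have hb := toEnv_bracket hG hx ha.1
      rw [sub_eq_iff_eq_add.1 hb.symm]
      have hxa := G.bracket_mem_deg _ _ _ _ hx ha.1
      refine add_mem ?_ (Submodule.smul_of_tower_mem _ _
        ((G.weightIdeal G.nonneg μ).smul_mem _
          (toEnv_mem_weightIdeal hn.ne' (deg_le_nonneg hn.le hx) hx)))
      rcases eq_or_ne n 1 with rfl | hn1
      · have h0 : g.bracket x a ∈ G.deg 0 := hxa
        have := toEnv_sub_mem_weightIdeal G.nonneg μ ⟨_, h0⟩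
        rwa [hμ ⟨_, h0⟩ ⟨x, hx, rfl⟩, map_zero, sub_zero] at this
      · exact toEnv_mem_weightIdeal (by omega) (deg_le_nonneg (by omega) hxa) hxa
  tfae_have 2 → 3 := by
    rintro ⟨a, ha, hμ⟩
    have hle := F.para_le_stabilizer hG h1 ha.1 (F.toEnv_mem_radical ha.1 hμ)
    refine F.isQuasifinite_irrDeg hG fun d hd => ?_
    have := ha.2.2.2 d hd
    exact finite_quotient_comap_mono (K := G.para a) fun x hx hxp =>
      F.toEnv_mem_radical_of_mem_stabilizer (hle hxp) hd.ne hx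
  tfae_have 3 → 2 := by
    intro hq
    -- (SP₃) for the stabilizer yields pᵃ inside it; then a kills the highest weight vector of L(μ),
    -- and so does [x, a] for x of degree 1/2.
    obtain ⟨a, ha, hle⟩ := h3 _ (F.isNondegParabolic_stabilizer hG h1 hinf hq)
    have hmem : a ∈ G.para a := Submodule.mem_sup_right <| Submodule.mem_iSup_of_mem 0 <|
      Submodule.mem_iSup_of_mem 0 (Submodule.mem_span_singleton_self a)
    exact ⟨a, ha, F.weight_bracket_eq_zero hG h1 ha.1
      (F.toEnv_mem_radical_of_mem_stabilizer (hle hmem) (by norm_num) ha.1)⟩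
  tfae_have 2 → 4 := by
    rintro ⟨a, ha, hμ⟩
    exact ⟨a, ha, F.isIrrQuotientOfGenVerma hG h1 le_sup_left
      (F.para_le_stabilizer hG h1 ha.1 (F.toEnv_mem_radical ha.1 hμ))⟩
  tfae_have 4 → 2 := by
    rintro ⟨a, ha, hv, -⟩
    have hmem : a ∈ G.para a := Submodule.mem_sup_right <| Submodule.mem_iSup_of_mem 0 <|
      Submodule.mem_iSup_of_mem 0 (Submodule.mem_span_singleton_self a)
    refine ⟨a, ha, fun h ⟨x, hx, hxa⟩ => hv h ?_⟩
    rw [← hxa]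
    exact Submodule.apply_mem_map₂ _ (Submodule.mem_sup_left (deg_le_nonneg zero_le_one hx)) hmem
  tfae_finish
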